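/- For a positive integer $m$ and an index $s$ let $H^s_{\mathrm{even},m}$ be the space of real functions $f(x)=\sum_{n\ge1}a_n\cos(nmx)$ and $H^s_{\mathrm{odd},m}$ the space of real functions $f(x)=\sum_{n\ge1}b_n\sin(nmx)$ with finite norm $\|f\|_{H^s}=\big(\sum_{n\ge1}\langle n\rangle^{2s}|a_n|^2\big)^{1/2}$, respectively $\|f\|_{H^s}=\big(\sum_{n\ge1}\langle n\rangle^{2s}|b_n|^2\big)^{1/2}$, where $\langle n\rangle=\max(1,n)$. Put $$X_m^s=H^{s+\frac14}_{\mathrm{even},m}\times H^{s-\frac14}_{\mathrm{odd},m},\qquad Y_m^s=H^{s-\frac54}_{\mathrm{odd},m}\times H^{s-\frac74}_{\mathrm{even},m},$$ $$B_m^s(r)=\{(\eta,\psi)\in X_m^s:\ \|\eta\|_{H^{s+1/4}}+\|\psi\|_{H^{s-1/4}}<r\}.$$ Write $\int_{\mathbb T}f(y)\,dy=\frac1{2\pi}\int_0^{2\pi}f(y)\,dy$, let p.v. denote the principal value at $y=x$, and set $R=\sqrt{1+2\eta}$, $$\mathscr D_0(\eta)[\omega](x)=\mathrm{p.v.}\int_{\mathbb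 T}\frac{1-\sqrt{\frac{1+2\eta(y)}{1+2\eta(x)}}\cos(x-y)}{1+\eta(x)+\eta(y)-R(x)R(y)\cos(x-y)}\,\omega(y)\,dy,$$ $$\mathscr H_0(\eta)[\omega](x)=\mathrm{p.v.}\int_{\mathbb T}\frac{R(x)R(y)\sin(x-y)}{1+\eta(x)+\eta(y)-R(x)R(y)\cos(x-y)}\,\omega(y)\,dy,$$ $$\mathscr H(\eta)[\omega]=\eta_x\,\mathscr D_0(\eta)[\omega]+\mathscr H_0(\eta)[\omega],$$ $$\mathscr K(\eta)=\frac{\eta_{xx}-2(\eta_x/R)^2}{\big(R^2+(\eta_x/R)^2\big)^{3/2}}-\big(R^2+(\eta_x/R)^2\big)^{-1/2},$$ $$F_1(c,\sigma,\gamma,\eta,\psi)=c\,\eta_x+\tfrac12\mathscr H(\eta)[\psi_x]+\tfrac\gamma2\mathscr H(\eta)[1],$$ $$F_2(c,\sigma,\gamma,\eta,\psi)=c\,\psi_x+\tfrac{\psi_x+\gamma}2\,\mathscr D_0(\eta)[\psi_x+\gamma]+\sigma\,\mathscr K(\eta),$$ where $F_2$ is considered modulo additive constants (constants in $x$, possibly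 depending on $c,\sigma,\gamma,\eta,\psi$), that is, it is identified with its representative of zero mean. **Proposition.** For every integer $m\ge1$ there is $s_0>0$ such that for every real $s\ge s_0$ there is $r=r(s)>0$ such that the functional $$F=(F_1,F_2):\ \mathbb R\times(0,\infty)\times\mathbb R\times B_m^s(r)\longrightarrow Y_m^s$$ is well defined (the derivatives and principal values in the formulas exist, $1+2\eta>0$, and the values lie in $Y_m^s$) and of class $C^1$. -/

import Mathlib

open Real Set Filter Topology MeasureTheory

noncomputable section

/-- The weight `⟨n⟩ = max (1, n)`, for positive integers `n`. -/
def japaneseBracket (n : ℕ+) : ℝ := max 1 (n : ℝ)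

theorem japaneseBracket_pos (n : ℕ+) : 0 < japaneseBracket n :=
  lt_of_lt_of_le one_pos (le_max_left _ _)

/-- Real sequences `(a_n)_{n ≥ 1}` for which `(⟨n⟩^s a_n)_{n ≥ 1}` is square summable, i.e.
`∑ ⟨n⟩^{2s} |a_n|^2 < ∞` (see `mem_sobolevCoeff_iff`). -/
def sobolevCoeff (s : ℝ) : Submodule ℝ (ℕ+ → ℝ) where
  carrier := {a | Memℓp (fun n => japaneseBracket n ^ s * a n) 2}
  zero_mem' := by
    have h : (fun n : ℕ+ => japaneseBracket n ^ s * (0 : ℕ+ → ℝ) n) = 0 := by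
      funext n; simp
    show Memℓp (fun n : ℕ+ => japaneseBracket n ^ s * (0 : ℕ+ → ℝ) n) 2
    rw [h]
    exact zero_memℓp
  add_mem' := by
    intro a b ha hb
    have h := Memℓp.add ha hb
    have e : (fun n : ℕ+ => japaneseBracket n ^ s * (a + b) n)
        = (fun n : ℕ+ => japaneseBracket n ^ s * a n)
          + (fun n : ℕ+ => japaneseBracket n ^ s * b n) := by
      funext n; simp [mul_add]
    show Memℓp (fun n : ℕ+ => japaneseBracket n ^ s * (a + b) n) 2
    rw [e]
    exact h
  smul_mem' := by
    intro t a ha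
    have h := Memℓp.const_smul ha t
    have e : (fun n : ℕ+ => japaneseBracket n ^ s * (t • a) n)
        = t • (fun n : ℕ+ => japaneseBracket n ^ s * a n) := by
      funext n; simp [mul_left_comm]
    show Memℓp (fun n : ℕ+ => japaneseBracket n ^ s * (t • a) n) 2
    rw [e]
    exact h

/-- The map `(a_n) ↦ (⟨n⟩^s a_n)` into `ℓ²`, through which the Sobolev norm is defined. -/
def sobolevToL2 (s : ℝ) : sobolevCoeff s →ₗ[ℝ] lp (fun _ : ℕ+ => ℝ) 2 where
  toFun a := ⟨fun n => japaneseBracket n ^ s * a.1 n, a.2⟩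
  map_add' a b := by
    ext n
    exact mul_add (japaneseBracket n ^ s) (a.1 n) (b.1 n)
  map_smul' t a := by
    ext n; simp [mul_left_comm]

theorem sobolevToL2_injective (s : ℝ) : Function.Injective (sobolevToL2 s) := by
  intro a b h
  ext n
  have h1 : japaneseBracket n ^ s * a.1 n = japaneseBracket n ^ s * b.1 n :=
    congrArg (fun v : lp (fun _ : ℕ+ => ℝ) 2 => v n) h
  exact mul_left_cancel₀ (rpow_pos_of_pos (japaneseBracket_pos n) s).ne' h1

instance sobolevCoeffNormed (s : ℝ) : NormedAddCommGroup (sobolevCoeff s) :=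
  NormedAddCommGroup.induced (sobolevCoeff s) (lp (fun _ : ℕ+ => ℝ) 2) (sobolevToL2 s)
    (sobolevToL2_injective s)

instance sobolevCoeffNormedSpace (s : ℝ) : NormedSpace ℝ (sobolevCoeff s) :=
  NormedSpace.induced ℝ (sobolevCoeff s) (lp (fun _ : ℕ+ => ℝ) 2) (sobolevToL2 s)

theorem sobolev_weight_sq (s : ℝ) (n : ℕ+) (t : ℝ) :
    (japaneseBracket n ^ s * t) ^ 2 = japaneseBracket n ^ (2 * s) * |t| ^ 2 := by
  rw [mul_pow, sq_abs, mul_comm 2 s, rpow_mul (japaneseBracket_pos n).le]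
  norm_num

theorem mem_sobolevCoeff_iff (s : ℝ) (a : ℕ+ → ℝ) :
    a ∈ sobolevCoeff s ↔ Summable fun n => japaneseBracket n ^ (2 * s) * |a n| ^ 2 := by
  show Memℓp (fun n => japaneseBracket n ^ s * a n) 2 ↔ _
  rw [memℓp_gen_iff (by norm_num)]
  simp only [ENNReal.toReal_ofNat, rpow_ofNat, norm_eq_abs, sq_abs, sobolev_weight_sq]

theorem sobolevCoeff_norm_sq (s : ℝ) (a : sobolevCoeff s) :
    ‖a‖ ^ 2 = ∑' n, japaneseBracket n ^ (2 * s) * |a.1 n| ^ 2 := by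
  have h := lp.norm_rpow_eq_tsum (p := 2) (by norm_num) (sobolevToL2 s a)
  have h1 : ‖a‖ = ‖sobolevToL2 s a‖ := rfl
  have h2 : ∀ n, (sobolevToL2 s a) n = japaneseBracket n ^ s * a.1 n := fun _ => rfl
  simp only [ENNReal.toReal_ofNat, rpow_ofNat, norm_eq_abs, sq_abs, h2, sobolev_weight_sq] at h
  rw [h1, h]
  simp only [sq_abs]

/-- The space `H^s_{even,m}` of the functions `f(x) = ∑_{n ≥ 1} a_n cos(n m x)` with
`∑ ⟨n⟩^{2s} |a_n|^2 < ∞`, with the norm `(∑ ⟨n⟩^{2s} |a_n|^2)^{1/2}`. An element is stored through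
its Fourier coefficients; the function itself is `HEven.toFun`. -/
def HEven (_m : ℕ) (s : ℝ) : Type := sobolevCoeff s

/-- The space `H^s_{odd,m}` of the functions `f(x) = ∑_{n ≥ 1} b_n sin(n m x)` with
`∑ ⟨n⟩^{2s} |b_n|^2 < ∞`, with the norm `(∑ ⟨n⟩^{2s} |b_n|^2)^{1/2}`. An element is stored through
its Fourier coefficients; the function itself is `HOdd.toFun`. -/
def HOdd (_m : ℕ) (s : ℝ) : Type := sobolevCoeff s

instance (m : ℕ) (s : ℝ) : NormedAddCommGroup (HEven m s) :=
  inferInstanceAs (NormedAddCommGroup (sobolevCoeff s))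

instance (m : ℕ) (s : ℝ) : NormedSpace ℝ (HEven m s) :=
  inferInstanceAs (NormedSpace ℝ (sobolevCoeff s))

instance (m : ℕ) (s : ℝ) : NormedAddCommGroup (HOdd m s) :=
  inferInstanceAs (NormedAddCommGroup (sobolevCoeff s))

instance (m : ℕ) (s : ℝ) : NormedSpace ℝ (HOdd m s) :=
  inferInstanceAs (NormedSpace ℝ (sobolevCoeff s))

/-- The `n`-th term `a_n cos(n m x)` of the Fourier series of an element of `H^s_{even,m}`. -/
def HEven.term {m : ℕ} {s : ℝ} (f : HEven m s) (x : ℝ) (n : ℕ+) : ℝ :=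
  Subtype.val (p := fun a => a ∈ sobolevCoeff s) f n * cos ((n : ℝ) * (m : ℝ) * x)

/-- The `n`-th term `b_n sin(n m x)` of the Fourier series of an element of `H^s_{odd,m}`. -/
def HOdd.term {m : ℕ} {s : ℝ} (f : HOdd m s) (x : ℝ) (n : ℕ+) : ℝ :=
  Subtype.val (p := fun a => a ∈ sobolevCoeff s) f n * sin ((n : ℝ) * (m : ℝ) * x)

/-- The function `x ↦ ∑_{n ≥ 1} a_n cos(n m x)`; the series converges absolutely if `s > 1/2`. -/
def HEven.toFun {m : ℕ} {s : ℝ} (f : HEven m s) (x : ℝ) : ℝ := ∑' n, f.term x n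

/-- The function `x ↦ ∑_{n ≥ 1} b_n sin(n m x)`; the series converges absolutely if `s > 1/2`. -/
def HOdd.toFun {m : ℕ} {s : ℝ} (f : HOdd m s) (x : ℝ) : ℝ := ∑' n, f.term x n

/-- `X_m^s = H^{s+1/4}_{even,m} × H^{s-1/4}_{odd,m}`. -/
abbrev XSpace (m : ℕ) (s : ℝ) : Type := HEven m (s + 1 / 4) × HOdd m (s - 1 / 4)

/-- `Y_m^s = H^{s-5/4}_{odd,m} × H^{s-7/4}_{even,m}`. -/
abbrev YSpace (m : ℕ) (s : ℝ) : Type := HOdd m (s - 5 / 4) × HEven m (s - 7 / 4)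

/-- `B_m^s(r)`: the pairs `(η, ψ)` in `X_m^s` with `‖η‖ + ‖ψ‖ < r`. -/
def smallBall (m : ℕ) (s r : ℝ) : Set (XSpace m s) := {u | ‖u.1‖ + ‖u.2‖ < r}

/-- The truncated integral `(1/2π) ∫ g(y) dy` over one period around `x`, namely
`ε < |x - y| ≤ π`. -/
def truncatedIntegral (g : ℝ → ℝ) (x ε : ℝ) : ℝ :=
  (2 * π)⁻¹ * ∫ y in {y : ℝ | ε < |x - y| ∧ |x - y| ≤ π}, g y

/-- The principal value integral of `g` over the torus, with singularity at `y = x` and with the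
normalized measure `dy / 2π`, exists. -/
def PVExists (g : ℝ → ℝ) (x : ℝ) : Prop :=
  (∀ ε : ℝ, 0 < ε → IntegrableOn g {y : ℝ | ε < |x - y| ∧ |x - y| ≤ π}) ∧
    ∃ L : ℝ, Tendsto (truncatedIntegral g x) (𝓝[>] 0) (𝓝 L)

/-- The principal value integral of `g` over the torus, with singularity at `y = x` and with the
normalized measure `dy / 2π`. It is meaningful when `PVExists g x`. -/
def pvIntegral (g : ℝ → ℝ) (x : ℝ) : ℝ := limUnder (𝓝[>] 0) (truncatedIntegral g x)

/-- The common denominator `1 + η(x) + η(y) - √(1+2η(x)) √(1+2η(y)) cos(x-y)`. -/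
def sheetDenominator (η : ℝ → ℝ) (x y : ℝ) : ℝ :=
  1 + η x + η y - √(1 + 2 * η x) * √(1 + 2 * η y) * cos (x - y)

/-- The integrand of `𝒟₀(η)[ω](x)`. -/
def D0Integrand (η ω : ℝ → ℝ) (x y : ℝ) : ℝ :=
  (1 - √((1 + 2 * η y) / (1 + 2 * η x)) * cos (x - y)) / sheetDenominator η x y * ω y

/-- The integrand of `ℋ₀(η)[ω](x)`. -/
def H0Integrand (η ω : ℝ → ℝ) (x y : ℝ) : ℝ :=
  √(1 + 2 * η x) * √(1 + 2 * η y) * sin (x - y) / sheetDenominator η x y * ω y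

/-- `𝒟₀(η)[ω](x)`. -/
def opD0 (η ω : ℝ → ℝ) (x : ℝ) : ℝ := pvIntegral (D0Integrand η ω x) x

/-- `ℋ₀(η)[ω](x)`. -/
def opH0 (η ω : ℝ → ℝ) (x : ℝ) : ℝ := pvIntegral (H0Integrand η ω x) x

/-- `ℋ(η)[ω] = η_x 𝒟₀(η)[ω] + ℋ₀(η)[ω]`. -/
def opH (η ω : ℝ → ℝ) (x : ℝ) : ℝ := deriv η x * opD0 η ω x + opH0 η ω x

/-- The curvature term `𝒦(η)`, with `R = √(1 + 2η)`. -/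
def sheetCurvature (η : ℝ → ℝ) (x : ℝ) : ℝ :=
  (deriv (deriv η) x - 2 * (deriv η x / √(1 + 2 * η x)) ^ 2)
      / (√(1 + 2 * η x) ^ 2 + (deriv η x / √(1 + 2 * η x)) ^ 2) ^ (3 / 2 : ℝ)
    - (√(1 + 2 * η x) ^ 2 + (deriv η x / √(1 + 2 * η x)) ^ 2) ^ (-(1 / 2) : ℝ)

/-- `F₁(c,σ,γ,η,ψ) = c η_x + ½ ℋ(η)[ψ_x] + (γ/2) ℋ(η)[1]` (it does not depend on `σ`). -/
def functionalF1 (c γ : ℝ) (η ψ : ℝ → ℝ) (x : ℝ) : ℝ :=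
  c * deriv η x + 1 / 2 * opH η (deriv ψ) x + γ / 2 * opH η (fun _ => 1) x

/-- `F₂(c,σ,γ,η,ψ) = c ψ_x + ((ψ_x + γ)/2) 𝒟₀(η)[ψ_x + γ] + σ 𝒦(η)`. -/
def functionalF2 (c σ γ : ℝ) (η ψ : ℝ → ℝ) (x : ℝ) : ℝ :=
  c * deriv ψ x + (deriv ψ x + γ) / 2 * opD0 η (fun y => deriv ψ y + γ) x
    + σ * sheetCurvature η x

/-- All the operations in the formulas for `F₁` and `F₂` are meaningful at `(γ, η, ψ)`: the
derivatives exist classically, the square roots are taken of positive numbers, and every principal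
value integral exists. (The denominators are then nonzero for `x - y ∉ 2πℤ`.) -/
structure FormulasMeaningful (γ : ℝ) (η ψ : ℝ → ℝ) : Prop where
  contDiff_η : ContDiff ℝ 2 η
  contDiff_ψ : ContDiff ℝ 1 ψ
  radius_pos : ∀ x, 0 < 1 + 2 * η x
  pv_D0_ψx : ∀ x, PVExists (D0Integrand η (deriv ψ) x) x
  pv_D0_one : ∀ x, PVExists (D0Integrand η (fun _ => 1) x) x
  pv_D0_ψx_add : ∀ x, PVExists (D0Integrand η (fun y => deriv ψ y + γ) x) x
  pv_H0_ψx : ∀ x, PVExists (H0Integrand η (deriv ψ) x) x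
  pv_H0_one : ∀ x, PVExists (H0Integrand η (fun _ => 1) x) x

end

/-! Put `u = exp (iθ)`, `y = x + θ`, `a = R(x)`, `b = R(y)`. Twice the common denominator equals `|a
- u b|²`, so both kernels are contained in the single complex kernel `2 / (a - u b)`: its real part
divided by `a` is the kernel of `𝒟₀`, and its imaginary part times `-a` is that of `ℋ₀`
(`kernel_re_im`, `pv_D0_H0`). This kernel factors as `2 / (1 - u)`, which is fixed and singular,
times `G = (1 - u) / (a - u b)`, which is regular. Indeed `(a - u b) / (1 - u) = a + u (a - b) / (1
- u)`, where `a - b = 2 (η(x) - η(y)) / (a + b)`, and on each Fourier mode of `η` the quotient `u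
(η(x) - η(y)) / (1 - u)` is a finite geometric sum in `u` (`one_sub_mul_eval_geomDiff`), at the cost
of one derivative.

Everything then takes place among functions of `(x, θ)` that are `H^t` in `x` with values in the
Wiener algebra `ℓ¹(ℤ)` in `θ`. For `t > 1` the product is bounded (`exists_conv_bound`). Near zero,
square roots come from the inverse function theorem (`exists_sqrt`) and reciprocals from inversion
of operators (`exists_inv`), both of class `C¹`; hence so is `G` (`exists_profile`). The principal
value of `2 u^k / (1 - u)` is `±1`, with truncated integrals bounded uniformly in `k`
(`exists_dirichletTail_bound`, `tendsto_dirichletTail`), so the principal value acts as a bounded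
linear operator on this space. Thus `F` is composed of bounded multilinear maps and of the `C¹` maps
above.

Parity needs no separate argument. All Fourier coefficients are kept real, so on `θ = 0` the real
part is a cosine series and the imaginary part a sine series. The odd function `η_x` enters as `i
η_x`; then `F₁` is an imaginary part, `F₂` a real part, and the mean of `F₂` is the discarded zeroth
coefficient. Only frequencies in `mℤ` occur in `x`, since shifting the mode `n m` by `θ` multiplies
it by `u^(n m)`. -/

noncomputable section


/-! ### The Wiener algebra in the angular variable. -/

/-- The Wiener algebra `ℓ¹(ℤ)`, with real Fourier coefficients. -/
abbrev Wiener : Type := lp (fun _ : ℤ => ℝ) 1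

namespace Wiener

theorem hasSum_norm (a : Wiener) : HasSum (fun k => ‖a k‖) ‖a‖ := by
  simpa using lp.hasSum_norm (p := 1) (by norm_num) a

/-- The basis vector `u ^ k`. -/
def mono (k : ℤ) : Wiener := lp.single 1 k 1

theorem norm_mono (k : ℤ) : ‖mono k‖ = 1 := by
  simp [mono, lp.norm_single]

section lift

variable {F : Type*} [NormedAddCommGroup F] [NormedSpace ℝ F]

theorem summable_norm_smul (z : ℤ → F) (hz : ∀ k, ‖z k‖ ≤ 1) (a : Wiener) :
    Summable fun k => ‖a k • z k‖ := by
  refine Summable.of_nonneg_of_le (fun _ => norm_nonneg _) (fun k => ?_) a.hasSum_norm.summable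
  rw [norm_smul]
  exact mul_le_of_le_one_right (norm_nonneg _) (hz k)

variable [CompleteSpace F]

theorem summable_smul (z : ℤ → F) (hz : ∀ k, ‖z k‖ ≤ 1) (a : Wiener) :
    Summable fun k => a k • z k := (summable_norm_smul z hz a).of_norm

/-- The operator on `ℓ¹(ℤ)` with prescribed values in the unit ball on the basis. -/
def lift (z : ℤ → F) (hz : ∀ k, ‖z k‖ ≤ 1) : Wiener →L[ℝ] F :=
  LinearMap.mkContinuous
    { toFun := fun a => ∑' k, a k • z k
      map_add' := fun a b => by
        rw [← (summable_smul z hz a).tsum_add (summable_smul z hz b)]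
        simp [add_smul]
      map_smul' := fun c a => by
        rw [RingHom.id_apply, ← (summable_smul z hz a).tsum_const_smul]
        simp [mul_smul] } 1 (fun a => by
      rw [one_mul, ← a.hasSum_norm.tsum_eq]
      refine (norm_tsum_le_tsum_norm (summable_norm_smul z hz a)).trans ?_
      refine (summable_norm_smul z hz a).tsum_le_tsum (fun k => ?_) a.hasSum_norm.summable
      rw [norm_smul]
      exact mul_le_of_le_one_right (norm_nonneg _) (hz k))

theorem lift_apply (z : ℤ → F) (hz : ∀ k, ‖z k‖ ≤ 1) (a : Wiener) :
    lift z hz a = ∑' k, a k • z k := rfl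

theorem hasSum_lift (z : ℤ → F) (hz : ∀ k, ‖z k‖ ≤ 1) (a : Wiener) :
    HasSum (fun k => a k • z k) (lift z hz a) := (summable_smul z hz a).hasSum

theorem norm_lift_le (z : ℤ → F) (hz : ∀ k, ‖z k‖ ≤ 1) : ‖lift z hz‖ ≤ 1 :=
  LinearMap.mkContinuous_norm_le _ zero_le_one _

theorem norm_lift_apply_le (z : ℤ → F) (hz : ∀ k, ‖z k‖ ≤ 1) (a : Wiener) :
    ‖lift z hz a‖ ≤ ‖a‖ := by
  simpa using (lift z hz).le_of_opNorm_le (norm_lift_le z hz) a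

theorem lift_mono (z : ℤ → F) (hz : ∀ k, ‖z k‖ ≤ 1) (k : ℤ) : lift z hz (mono k) = z k := by
  rw [lift_apply, tsum_eq_single k]
  · simp [mono]
  · intro j hj
    simp [mono, Pi.single_eq_of_ne hj]

end lift

/-- Convolution on `ℓ¹(ℤ)`. -/
def mul : Wiener →L[ℝ] Wiener →L[ℝ] Wiener :=
  lift (fun k => lift (fun j => mono (k + j)) fun _ => (norm_mono _).le) fun _ => norm_lift_le _ _

theorem norm_mul_le (a b : Wiener) : ‖mul a b‖ ≤ ‖a‖ * ‖b‖ :=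
  (mul a).le_of_opNorm_le (norm_lift_apply_le _ _ a) b

theorem norm_exp_int (k : ℤ) (θ : ℝ) : ‖Complex.exp (k * θ * Complex.I)‖ ≤ 1 := by
  have h := Complex.norm_exp_ofReal_mul_I (k * θ)
  push_cast at h
  exact h.le

/-- The sum of the Fourier series at `u = exp (i θ)`. -/
def eval (θ : ℝ) : Wiener →L[ℝ] ℂ :=
  lift (fun k => Complex.exp (k * θ * Complex.I)) fun k => norm_exp_int k θ

theorem eval_mono (θ : ℝ) (k : ℤ) : eval θ (mono k) = Complex.exp (k * θ * Complex.I) :=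
  lift_mono _ _ k

/-- On monomials this is `u^k u^j = u^(k+j)`; expanding the two factors one after the other extends
it by continuity. -/
theorem eval_mul (θ : ℝ) (a b : Wiener) : eval θ (mul a b) = eval θ a * eval θ b := by
  have h1 : HasSum (fun k => a k • eval θ (lift (fun j => mono (k + j))
      (fun _ => (norm_mono _).le) b)) (eval θ (mul a b)) := by
    have h := (hasSum_lift (fun k => lift (fun j => mono (k + j)) fun _ => (norm_mono _).le)
      (fun _ => norm_lift_le _ _) a).mapL (ContinuousLinearMap.apply ℝ Wiener b)
    simpa [mul] using h.mapL (eval θ)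
  have h2 : ∀ k : ℤ, eval θ (lift (fun j => mono (k + j)) (fun _ => (norm_mono _).le) b)
      = Complex.exp (k * θ * Complex.I) * eval θ b := by
    intro k
    have h := (hasSum_lift (fun j => mono (k + j)) (fun _ => (norm_mono _).le) b).mapL (eval θ)
    refine h.unique ?_
    refine ((hasSum_lift _ _ b).mul_left (Complex.exp (k * θ * Complex.I))).congr_fun ?_ 
    intro j
    rw [map_smul, eval_mono, mul_smul_comm, ← Complex.exp_add]
    push_cast
    ring_nf
  refine h1.unique ?_
  refine ((hasSum_lift _ _ a).mul_right (eval θ b)).congr_fun fun k => ?_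
  rw [h2, smul_mul_assoc]

end Wiener


/-! ### Weights and weighted convolution of square summable sequences. -/

/-- The weight `⟨n⟩ ^ t`, for integers `n`. -/
def wt (t : ℝ) (n : ℤ) : ℝ := (max 1 |(n : ℝ)|) ^ t

theorem wt_pos (t : ℝ) (n : ℤ) : 0 < wt t n :=
  rpow_pos_of_pos (lt_of_lt_of_le one_pos (le_max_left _ _)) t

theorem one_le_wt {t : ℝ} (ht : 0 ≤ t) (n : ℤ) : 1 ≤ wt t n :=
  one_le_rpow (le_max_left _ _) ht

theorem wt_zero_right (t : ℝ) : wt t 0 = 1 := by simp [wt]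

theorem wt_le_add {t : ℝ} (ht : 0 ≤ t) (n k : ℤ) :
    wt t n ≤ 2 ^ t * (wt t k + wt t (n - k)) := by
  have h1 : max 1 |(n : ℝ)| ≤ 2 * max (max 1 |(k : ℝ)|) (max 1 |((n - k : ℤ) : ℝ)|) := by
    have := abs_add_le (k : ℝ) ((n - k : ℤ) : ℝ)
    have e : (k : ℝ) + ((n - k : ℤ) : ℝ) = n := by push_cast; ring
    rw [e] at this
    rcases max_choice (max 1 |(k : ℝ)|) (max 1 |((n - k : ℤ) : ℝ)|) with h | h <;>
    · rw [h]
      have a1 := le_max_left (max 1 |(k : ℝ)|) (max 1 |((n - k : ℤ) : ℝ)|)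
      have a2 := le_max_right (max 1 |(k : ℝ)|) (max 1 |((n - k : ℤ) : ℝ)|)
      have a3 := le_max_left 1 |(k : ℝ)|
      have a4 := le_max_right 1 |(k : ℝ)|
      have a5 := le_max_left 1 |((n - k : ℤ) : ℝ)|
      have a6 := le_max_right 1 |((n - k : ℤ) : ℝ)|
      rw [h] at a1 a2
      apply max_le <;> linarith
  calc wt t n ≤ (2 * max (max 1 |(k : ℝ)|) (max 1 |((n - k : ℤ) : ℝ)|)) ^ t :=
        rpow_le_rpow (by positivity) h1 ht
    _ = 2 ^ t * (max (max 1 |(k : ℝ)|) (max 1 |((n - k : ℤ) : ℝ)|)) ^ t :=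
        mul_rpow (by norm_num) (by positivity)
    _ ≤ _ := by
        refine mul_le_mul_of_nonneg_left ?_ (by positivity)
        have p1 := (wt_pos t k).le
        have p2 := (wt_pos t (n - k)).le
        rcases max_choice (max 1 |(k : ℝ)|) (max 1 |((n - k : ℤ) : ℝ)|) with h | h <;> rw [h]
        · exact le_add_of_nonneg_right p2
        · exact le_add_of_nonneg_left p1

theorem summable_inv_wt {t : ℝ} (ht : 1 < t) : Summable fun n => (wt t n)⁻¹ := by
  refine (Real.summable_abs_int_rpow ht).of_norm_bounded_eventually ?_
  have : {n : ℤ | n ≠ 0} ∈ (cofinite : Filter ℤ) := by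
    rw [mem_cofinite]; convert finite_singleton (0 : ℤ); ext; simp
  filter_upwards [this] with n hn
  rw [norm_of_nonneg (inv_nonneg.2 (wt_pos t n).le), wt, max_eq_right, rpow_neg (abs_nonneg _)]
  exact_mod_cast Int.one_le_abs hn

/-- The kernel of the convolution in the weighted spaces. -/
def convKernel (t : ℝ) (n k : ℤ) : ℝ := wt t n / (wt t k * wt t (n - k))

theorem convKernel_pos (t : ℝ) (n k : ℤ) : 0 < convKernel t n k :=
  div_pos (wt_pos _ _) (mul_pos (wt_pos _ _) (wt_pos _ _))

/-- The kernel is at most `2^t (p + q)` with `p = ⟨k⟩⁻ᵗ` and `q = ⟨n-k⟩⁻ᵗ`. As `p, q ≤ 1`, also `(p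
+ q)² ≤ 2 (p + q)`. Giving up one power here is what makes `t > 1`, instead of `t > 1/2`, the
condition for summability. -/
theorem convKernel_sq_le {t : ℝ} (ht : 0 ≤ t) (n k : ℤ) :
    convKernel t n k ^ 2 ≤ 2 * (2 ^ t) ^ 2 * ((wt t k)⁻¹ + (wt t (n - k))⁻¹) := by
  have p1 := wt_pos t k
  have p2 := wt_pos t (n - k)
  have h : convKernel t n k ≤ 2 ^ t * ((wt t k)⁻¹ + (wt t (n - k))⁻¹) := by
    rw [convKernel, div_le_iff₀ (mul_pos p1 p2)]
    refine (wt_le_add ht n k).trans (le_of_eq ?_)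
    field_simp
    ring
  have q1 := inv_le_one_of_one_le₀ (one_le_wt ht k)
  have q2 := inv_le_one_of_one_le₀ (one_le_wt ht (n - k))
  have r1 := (inv_pos.2 p1).le
  have r2 := (inv_pos.2 p2).le
  calc convKernel t n k ^ 2 ≤ (2 ^ t * ((wt t k)⁻¹ + (wt t (n - k))⁻¹)) ^ 2 :=
        pow_le_pow_left₀ (convKernel_pos _ _ _).le h 2
    _ = (2 ^ t) ^ 2 * ((wt t k)⁻¹ + (wt t (n - k))⁻¹) ^ 2 := mul_pow _ _ _
    _ ≤ (2 ^ t) ^ 2 * (2 * ((wt t k)⁻¹ + (wt t (n - k))⁻¹)) := by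
        refine mul_le_mul_of_nonneg_left ?_ (by positivity)
        nlinarith
    _ = _ := by ring

/-- The change of variables `(n, k) ↦ (k, n - k)`. -/
def convEquiv : ℤ × ℤ ≃ ℤ × ℤ where
  toFun p := (p.2, p.1 - p.2)
  invFun p := (p.1 + p.2, p.1)
  left_inv p := by simp
  right_inv p := by simp

/-- By Cauchy–Schwarz in `k`, the square of the `n`-th sum is at most `∑ₖ K(n,k)²`, bounded
independently of `n`, times `∑ₖ a_k² b_{n-k}²`. The latter sums over `n` to `α β`. -/
theorem exists_conv_bound {t : ℝ} (ht : 1 < t) :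
    ∃ C : ℝ, 0 ≤ C ∧ ∀ (a b : ℤ → ℝ) (α β : ℝ), (∀ n, 0 ≤ a n) → (∀ n, 0 ≤ b n) →
      HasSum (fun n => a n ^ 2) α → HasSum (fun n => b n ^ 2) β →
      (∀ n, Summable fun k => convKernel t n k * (a k * b (n - k))) ∧
      (Summable fun n => (∑' k, convKernel t n k * (a k * b (n - k))) ^ 2) ∧
      ∑' n, (∑' k, convKernel t n k * (a k * b (n - k))) ^ 2 ≤ C * (α * β) := by
  have ht0 : 0 ≤ t := by linarith
  set S := ∑' n, (wt t n)⁻¹ with hS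
  have hs := summable_inv_wt ht
  have hshift : ∀ n : ℤ, HasSum (fun k => (wt t (n - k))⁻¹) S := fun n =>
    ((Equiv.subLeft n).hasSum_iff (f := fun k => (wt t k)⁻¹)).2 hs.hasSum
  have hS0 : 0 ≤ S := tsum_nonneg fun n => inv_nonneg.2 (wt_pos t n).le
  set D : ℝ := 2 * (2 ^ t) ^ 2 with hD
  have hD0 : 0 ≤ D := by positivity
  have hK : ∀ n, HasSum (fun k => D * ((wt t k)⁻¹ + (wt t (n - k))⁻¹)) (D * (S + S)) := fun n =>
    (hs.hasSum.add (hshift n)).mul_left D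
  refine ⟨D * (S + S), by positivity, fun a b α β ha hb hα hβ => ?_⟩
  have hprod : HasSum (fun p : ℤ × ℤ => a p.1 ^ 2 * b p.2 ^ 2) (α * β) :=
    hα.mul hβ (hα.summable.mul_of_nonneg hβ.summable (fun _ => sq_nonneg _) fun _ => sq_nonneg _)
  have hprod' : HasSum (fun p : ℤ × ℤ => a p.2 ^ 2 * b (p.1 - p.2) ^ 2) (α * β) :=
    (convEquiv.hasSum_iff (f := fun p : ℤ × ℤ => a p.1 ^ 2 * b p.2 ^ 2)).2 hprod
  have hT : ∀ n, Summable fun k => a k ^ 2 * b (n - k) ^ 2 := fun n =>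
    hprod'.summable.prod_factor n
  have hTs : HasSum (fun n => ∑' k, a k ^ 2 * b (n - k) ^ 2) (α * β) :=
    hprod'.prod_fiberwise fun n => (hT n).hasSum
  have hsum : ∀ n, Summable fun k => convKernel t n k * (a k * b (n - k)) := by
    intro n
    refine Summable.of_nonneg_of_le (fun k => ?_) (fun k => ?_) ((hK n).summable.add (hT n))
    · exact mul_nonneg (convKernel_pos _ _ _).le (mul_nonneg (ha _) (hb _))
    · have := convKernel_sq_le ht0 n k
      have h2 := two_mul_le_add_sq (convKernel t n k) (a k * b (n - k))
      nlinarith [mul_nonneg (convKernel_pos t n k).le (mul_nonneg (ha k) (hb (n - k)))]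
  have hbd : ∀ n, (∑' k, convKernel t n k * (a k * b (n - k))) ^ 2
      ≤ (D * (S + S)) * ∑' k, a k ^ 2 * b (n - k) ^ 2 := by
    intro n
    have hT0 : 0 ≤ ∑' k, a k ^ 2 * b (n - k) ^ 2 := tsum_nonneg fun k => by positivity
    have h0 : 0 ≤ ∑' k, convKernel t n k * (a k * b (n - k)) := tsum_nonneg fun k =>
      mul_nonneg (convKernel_pos _ _ _).le (mul_nonneg (ha _) (hb _))
    rw [← Real.le_sqrt h0 (by positivity)]
    refine (hsum n).tsum_le_of_sum_le fun s => ?_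
    apply Real.le_sqrt_of_sq_le
    refine (Finset.sum_mul_sq_le_sq_mul_sq s _ _).trans ?_
    refine mul_le_mul ?_ ?_ (Finset.sum_nonneg fun _ _ => sq_nonneg _) (by positivity)
    · refine (Finset.sum_le_sum fun k _ => convKernel_sq_le ht0 n k).trans ?_
      exact sum_le_hasSum s (fun k _ => mul_nonneg hD0
        (add_nonneg (inv_nonneg.2 (wt_pos _ _).le) (inv_nonneg.2 (wt_pos _ _).le))) (hK n)
    · simp only [mul_pow]
      exact (hT n).sum_le_tsum s fun k _ => by positivity
  have hsq : Summable fun n => (∑' k, convKernel t n k * (a k * b (n - k))) ^ 2 :=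
    Summable.of_nonneg_of_le (fun _ => sq_nonneg _) hbd (hTs.summable.mul_left _)
  refine ⟨hsum, hsq, ?_⟩
  refine (hsq.tsum_le_tsum hbd (hTs.summable.mul_left _)).trans (le_of_eq ?_)
  rw [tsum_mul_left, hTs.tsum_eq]

/-! ### The algebra of functions of `(x, θ)`. -/

/-- Weighted Fourier coefficients of functions of `(x, θ)`: the element `v`, at regularity `t`,
represents `∑ₙ ⟨n⟩⁻ᵗ exp (i n m x) vₙ(θ)`. -/
abbrev TorusSeries : Type := lp (fun _ : ℤ => Wiener) 2

namespace TorusSeries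

theorem hasSum_norm_sq (v : TorusSeries) : HasSum (fun n => ‖v n‖ ^ 2) (‖v‖ ^ 2) := by
  simpa using lp.hasSum_norm (p := 2) (by norm_num) v

theorem norm_le_of_hasSum {v : TorusSeries} {C : ℝ} (hC : 0 ≤ C) {f : ℤ → ℝ} (hf : Summable f)
    (h : ∀ n, ‖v n‖ ^ 2 ≤ f n) (hfC : ∑' n, f n ≤ C ^ 2) : ‖v‖ ≤ C := by
  have h1 := v.hasSum_norm_sq
  have h2 := h1.summable.tsum_le_tsum h hf
  rw [h1.tsum_eq] at h2
  exact le_of_sq_le_sq (h2.trans hfC) hC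

theorem norm_apply_le (v : TorusSeries) (n : ℤ) : ‖v n‖ ≤ ‖v‖ :=
  lp.norm_apply_le_norm (by norm_num) v n

/-- The `n`-th coefficient of the product. -/
def mulCoeff (t : ℝ) (v w : ℤ → Wiener) (n : ℤ) : Wiener :=
  ∑' k, convKernel t n k • Wiener.mul (v k) (w (n - k))

variable {t : ℝ}

theorem norm_mulTerm_le (v w : TorusSeries) (n k : ℤ) :
    ‖convKernel t n k • Wiener.mul (v k) (w (n - k))‖
      ≤ convKernel t n k * (‖v k‖ * ‖w (n - k)‖) := by
  rw [norm_smul, norm_of_nonneg (convKernel_pos _ _ _).le]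
  exact mul_le_mul_of_nonneg_left (Wiener.norm_mul_le _ _) (convKernel_pos _ _ _).le

theorem summable_mulTerm (ht : 1 < t) (v w : TorusSeries) (n : ℤ) :
    Summable fun k => ‖convKernel t n k • Wiener.mul (v k) (w (n - k))‖ := by
  obtain ⟨C, -, h⟩ := exists_conv_bound ht
  exact Summable.of_nonneg_of_le (fun _ => norm_nonneg _) (fun k => norm_mulTerm_le v w n k)
    ((h _ _ _ _ (fun _ => norm_nonneg _) (fun _ => norm_nonneg _) v.hasSum_norm_sq
      w.hasSum_norm_sq).1 n)

theorem norm_mulCoeff_le (ht : 1 < t) (v w : TorusSeries) (n : ℤ) :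
    ‖mulCoeff t v w n‖ ≤ ∑' k, convKernel t n k * (‖v k‖ * ‖w (n - k)‖) := by
  obtain ⟨C, -, h⟩ := exists_conv_bound ht
  refine (norm_tsum_le_tsum_norm (summable_mulTerm ht v w n)).trans ?_
  exact (summable_mulTerm ht v w n).tsum_le_tsum (fun k => norm_mulTerm_le v w n k)
    ((h _ _ _ _ (fun _ => norm_nonneg _) (fun _ => norm_nonneg _) v.hasSum_norm_sq
      w.hasSum_norm_sq).1 n)

theorem exists_mulCoeff_bound (ht : 1 < t) : ∃ C : ℝ, 0 ≤ C ∧ ∀ v w : TorusSeries,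
    (Summable fun n => ‖mulCoeff t v w n‖ ^ 2) ∧
      ∑' n, ‖mulCoeff t v w n‖ ^ 2 ≤ C * (‖v‖ ^ 2 * ‖w‖ ^ 2) := by
  obtain ⟨C, hC, h⟩ := exists_conv_bound ht
  refine ⟨C, hC, fun v w => ?_⟩
  obtain ⟨-, h2, h3⟩ := h _ _ _ _ (fun _ => norm_nonneg _) (fun _ => norm_nonneg _)
    v.hasSum_norm_sq w.hasSum_norm_sq
  have h4 : ∀ n, ‖mulCoeff t v w n‖ ^ 2 ≤ (∑' k, convKernel t n k * (‖v k‖ * ‖w (n - k)‖)) ^ 2 :=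
    fun n => pow_le_pow_left₀ (norm_nonneg _) (norm_mulCoeff_le ht v w n) 2
  have h5 := Summable.of_nonneg_of_le (fun _ => sq_nonneg _) h4 h2
  exact ⟨h5, (h5.tsum_le_tsum h4 h2).trans h3⟩

theorem memℓp_mulCoeff (ht : 1 < t) (v w : TorusSeries) : Memℓp (mulCoeff t v w) 2 := by
  obtain ⟨C, -, h⟩ := exists_mulCoeff_bound ht
  exact memℓp_gen (by simpa using (h v w).1)

/-- The product of functions, at regularity `t`. -/
def mul (ht : 1 < t) : TorusSeries →L[ℝ] TorusSeries →L[ℝ] TorusSeries :=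
  LinearMap.mkContinuous₂
    (LinearMap.mk₂ ℝ (fun v w => (⟨mulCoeff t v w, memℓp_mulCoeff ht v w⟩ : TorusSeries))
      (fun v v' w => by
        ext1; funext n
        change mulCoeff t (v + v' : TorusSeries) w n = mulCoeff t v w n + mulCoeff t v' w n
        refine ((((summable_mulTerm ht v w n).of_norm.hasSum.add
          (summable_mulTerm ht v' w n).of_norm.hasSum)).congr_fun fun k => ?_).tsum_eq
        simp)
      (fun c v w => by
        ext1; funext n
        change mulCoeff t (c • v : TorusSeries) w n = c • mulCoeff t v w n
        refine (((summable_mulTerm ht v w n).of_norm.hasSum.const_smul c).congr_fun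
          fun k => ?_).tsum_eq
        simp [smul_comm c])
      (fun v w w' => by
        ext1; funext n
        change mulCoeff t v (w + w' : TorusSeries) n = mulCoeff t v w n + mulCoeff t v w' n
        refine ((((summable_mulTerm ht v w n).of_norm.hasSum.add
          (summable_mulTerm ht v w' n).of_norm.hasSum)).congr_fun fun k => ?_).tsum_eq
        simp)
      (fun c v w => by
        ext1; funext n
        change mulCoeff t v (c • w : TorusSeries) n = c • mulCoeff t v w n
        refine (((summable_mulTerm ht v w n).of_norm.hasSum.const_smul c).congr_fun
          fun k => ?_).tsum_eq
        simp [smul_comm c]))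
    (√(exists_mulCoeff_bound ht).choose) (fun v w => by
      obtain ⟨hC, h⟩ := (exists_mulCoeff_bound ht).choose_spec
      refine norm_le_of_hasSum (by positivity) (h v w).1 (fun n => le_rfl) ((h v w).2.trans ?_)
      rw [mul_pow, mul_pow, Real.sq_sqrt hC, mul_assoc])

/-- The factor `⟨n⟩⁻ᵗ exp (i n m x)`. -/
def waveCoeff (m : ℕ) (t x : ℝ) (n : ℤ) : ℂ :=
  ((wt t n)⁻¹ : ℝ) * Complex.exp (n * m * x * Complex.I)

theorem norm_waveCoeff (m : ℕ) (t x : ℝ) (n : ℤ) : ‖waveCoeff m t x n‖ = (wt t n)⁻¹ := by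
  have h := Complex.norm_exp_ofReal_mul_I (n * m * x)
  push_cast at h
  rw [waveCoeff, norm_mul, h, mul_one, Complex.norm_real,
    norm_of_nonneg (inv_nonneg.2 (wt_pos t n).le)]

/-- The weights are stored in the coefficients, so the product of functions becomes a convolution
with kernel `convKernel`; this identity is the reason for the form of that kernel. -/
theorem waveCoeff_mul_convKernel (m : ℕ) (t x : ℝ) (n k : ℤ) :
    waveCoeff m t x n * (convKernel t n k : ℝ) = waveCoeff m t x k * waveCoeff m t x (n - k) := by
  have h : ((n : ℂ) * m * x * Complex.I)
      = (k : ℂ) * m * x * Complex.I + ((n - k : ℤ) : ℂ) * m * x * Complex.I := by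
    push_cast; ring
  have h1 : ((wt t n : ℝ) : ℂ) ≠ 0 := Complex.ofReal_ne_zero.2 (wt_pos t n).ne'
  rw [waveCoeff, waveCoeff, waveCoeff, h, Complex.exp_add, convKernel]
  push_cast
  field_simp

/-- The functional `v ↦ ∑ₙ ⟨n⟩⁻ᵗ exp (i n m x) φ(vₙ)`. -/
def evalWith (m : ℕ) (t x : ℝ) (φ : Wiener →L[ℝ] ℂ) : TorusSeries →L[ℝ] ℂ :=
  ∑' n, waveCoeff m t x n • φ ∘L lp.evalCLM ℝ (fun _ : ℤ => Wiener) 2 n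

theorem norm_evalWith_term_le (m : ℕ) (t x : ℝ) (φ : Wiener →L[ℝ] ℂ) (n : ℤ) :
    ‖waveCoeff m t x n • φ ∘L lp.evalCLM ℝ (fun _ : ℤ => Wiener) 2 n‖ ≤ (wt t n)⁻¹ * ‖φ‖ := by
  rw [norm_smul, norm_waveCoeff]
  refine mul_le_mul_of_nonneg_left ?_ (inv_nonneg.2 (wt_pos t n).le)
  refine ContinuousLinearMap.opNorm_le_bound _ (norm_nonneg _) fun v => ?_
  exact (φ.le_opNorm _).trans (mul_le_mul_of_nonneg_left (norm_apply_le v n) (norm_nonneg _))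

theorem summable_evalWith_term (ht : 1 < t) (m : ℕ) (x : ℝ) (φ : Wiener →L[ℝ] ℂ) :
    Summable fun n => ‖waveCoeff m t x n • φ ∘L lp.evalCLM ℝ (fun _ : ℤ => Wiener) 2 n‖ :=
  Summable.of_nonneg_of_le (fun _ => norm_nonneg _) (norm_evalWith_term_le m t x φ)
    ((summable_inv_wt ht).mul_right _)

theorem hasSum_evalWith (ht : 1 < t) (m : ℕ) (x : ℝ) (φ : Wiener →L[ℝ] ℂ) (v : TorusSeries) :
    HasSum (fun n => waveCoeff m t x n * φ (v n)) (evalWith m t x φ v) := by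
  have h := (summable_evalWith_term ht m x φ).of_norm.hasSum.mapL
    (ContinuousLinearMap.apply ℝ ℂ v)
  exact h

theorem norm_evalWith_le (ht : 1 < t) (m : ℕ) (x : ℝ) (φ : Wiener →L[ℝ] ℂ) :
    ‖evalWith m t x φ‖ ≤ (∑' n, (wt t n)⁻¹) * ‖φ‖ := by
  refine (norm_tsum_le_tsum_norm (summable_evalWith_term ht m x φ)).trans ?_
  rw [← tsum_mul_right]
  exact (summable_evalWith_term ht m x φ).tsum_le_tsum (norm_evalWith_term_le m t x φ)
    ((summable_inv_wt ht).mul_right _)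

theorem summable_norm_evalWith (ht : 1 < t) (m : ℕ) (x : ℝ) (φ : Wiener →L[ℝ] ℂ)
    (v : TorusSeries) : Summable fun n => ‖waveCoeff m t x n * φ (v n)‖ := by
  refine Summable.of_nonneg_of_le (fun _ => norm_nonneg _) (fun n => ?_)
    ((summable_inv_wt ht).mul_right (‖φ‖ * ‖v‖))
  rw [norm_mul, norm_waveCoeff]
  refine mul_le_mul_of_nonneg_left ?_ (inv_nonneg.2 (wt_pos t n).le)
  exact (φ.le_opNorm _).trans (mul_le_mul_of_nonneg_left (norm_apply_le v n) (norm_nonneg _))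

/-- Reindexing the absolutely convergent double series by `(n, k) ↦ (k, n - k)` turns the product of
two values into the series of the convolution. -/
theorem evalWith_mul (ht : 1 < t) (m : ℕ) (x : ℝ) (φ : Wiener →L[ℝ] ℂ)
    (hφ : ∀ a b, φ (Wiener.mul a b) = φ a * φ b) (v w : TorusSeries) :
    evalWith m t x φ (mul ht v w) = evalWith m t x φ v * evalWith m t x φ w := by
  have key : ∀ f g : ℤ → ℂ, ∀ α β : ℂ, (Summable fun n => ‖f n‖) → (Summable fun n => ‖g n‖) →
      HasSum f α → HasSum g β → HasSum (fun p : ℤ × ℤ => f p.2 * g (p.1 - p.2)) (α * β) := by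
    intro f g α β hf hg hα hβ
    exact (convEquiv.hasSum_iff (f := fun p : ℤ × ℤ => f p.1 * g p.2)).2
      (hα.mul hβ (summable_mul_of_summable_norm hf hg))
  have h2 := key _ _ _ _ (summable_norm_evalWith ht m x φ v) (summable_norm_evalWith ht m x φ w)
    (hasSum_evalWith ht m x φ v) (hasSum_evalWith ht m x φ w)
  have h3 : ∀ n, HasSum (fun k => (waveCoeff m t x k * φ (v k))
      * (waveCoeff m t x (n - k) * φ (w (n - k)))) (waveCoeff m t x n * φ (mul ht v w n)) := by
    intro n
    have h := (((summable_mulTerm ht v w n).of_norm.hasSum.mapL φ).mul_left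
      (waveCoeff m t x n))
    refine h.congr_fun fun k => ?_
    rw [map_smul, hφ, Complex.real_smul]
    linear_combination -(φ (v k) * φ (w (n - k))) * waveCoeff_mul_convKernel m t x n k
  exact (hasSum_evalWith ht m x φ _).unique (HasSum.prod_fiberwise h2 h3)

/-- The value at `(x, θ)`. -/
def ev (m : ℕ) (t x θ : ℝ) : TorusSeries →L[ℝ] ℂ := evalWith m t x (Wiener.eval θ)

theorem ev_mul (ht : 1 < t) (m : ℕ) (x θ : ℝ) (v w : TorusSeries) :
    ev m t x θ (mul ht v w) = ev m t x θ v * ev m t x θ w :=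
  evalWith_mul ht m x _ (Wiener.eval_mul θ) v w

theorem exists_ev_bound (ht : 1 < t) (m : ℕ) :
    ∃ C : ℝ, ∀ x θ v, ‖ev m t x θ v‖ ≤ C * ‖v‖ := by
  refine ⟨∑' n, (wt t n)⁻¹, fun x θ v => ?_⟩
  refine ContinuousLinearMap.le_of_opNorm_le _ ((norm_evalWith_le ht m x _).trans ?_) v
  refine mul_le_of_le_one_right (tsum_nonneg fun n => inv_nonneg.2 (wt_pos t n).le) ?_
  exact Wiener.norm_lift_le _ _

/-- The constant function with value one. -/
def one : TorusSeries := lp.single 2 0 (Wiener.mono 0)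

theorem evalWith_single (ht : 1 < t) (m : ℕ) (x : ℝ) (φ : Wiener →L[ℝ] ℂ) (n : ℤ) (a : Wiener) :
    evalWith m t x φ (lp.single 2 n a) = waveCoeff m t x n * φ a := by
  refine (hasSum_evalWith ht m x φ _).unique ?_
  convert hasSum_single n ?_ using 2
  · simp
  · intro k hk
    simp [Pi.single_eq_of_ne hk]

theorem ev_one (ht : 1 < t) (m : ℕ) (x θ : ℝ) : ev m t x θ one = 1 := by
  rw [ev, one, evalWith_single ht, Wiener.eval_mono]
  simp [waveCoeff, wt_zero_right]

end TorusSeries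


/-! ### Truncated Dirichlet integrals. -/

theorem one_sub_cos_le_abs (t : ℝ) : 1 - cos t ≤ |t| := by
  have h1 := Real.one_sub_sq_div_two_le_cos (x := t)
  have h2 := Real.neg_one_le_cos t
  rcases le_total |t| 2 with h | h
  · nlinarith [sq_abs t, abs_nonneg t]
  · linarith

/-- Combines `1 - cos t ≤ t²/2` and `1 - cos t ≤ 2` into one bound, so that the majorant below is
the derivative of an arctangent. -/
theorem one_sub_cos_mul_le (t : ℝ) : (1 - cos t) * (1 + t ^ 2) ≤ 5 / 2 * t ^ 2 := by
  have h1 := Real.one_sub_sq_div_two_le_cos (x := t)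
  have h2 := Real.neg_one_le_cos t
  nlinarith [sq_nonneg t]

theorem sin_half_pos {θ : ℝ} (h0 : 0 < θ) (h1 : θ ≤ π) : 0 < sin (θ / 2) :=
  sin_pos_of_pos_of_lt_pi (by linarith) (by linarith [pi_pos])

theorem le_sin_half {θ : ℝ} (h0 : 0 ≤ θ) (h1 : θ ≤ π) : θ / π ≤ sin (θ / 2) := by
  have := Real.mul_le_sin (x := θ / 2) (by linarith) (by linarith)
  calc θ / π = 2 / π * (θ / 2) := by ring
    _ ≤ _ := this

/-- The truncated integral of a Dirichlet kernel. -/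
def dirichletTail (N ε : ℝ) : ℝ := ∫ θ in ε..π, sin (N * θ) / sin (θ / 2)

theorem continuousOn_div_sin_half {f : ℝ → ℝ} (hf : Continuous f) {ε : ℝ} (h0 : 0 < ε)
    (h1 : ε ≤ π) : ContinuousOn (fun θ => f θ / sin (θ / 2)) (uIcc ε π) := by
  refine hf.continuousOn.div (by fun_prop) fun θ hθ => ?_
  rw [uIcc_of_le h1] at hθ
  exact (sin_half_pos (h0.trans_le hθ.1) hθ.2).ne'

/-- Integration by parts, with `(1 - cos Nθ) / N` as primitive of `sin Nθ`. The boundary terms lie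
in `[0, π]`, and the remaining integrand is nonnegative with an integral bounded independently of
`N` and `ε`. -/
theorem abs_dirichletTail_le_of_pos {N ε : ℝ} (hN : 0 < N) (h0 : 0 < ε) (h1 : ε ≤ π) :
    |dirichletTail N ε| ≤ 2 * π + 5 * π ^ 2 / 4 * (π / 2) := by
  set K : ℝ → ℝ := fun θ => (1 - cos (N * θ)) / (N * sin (θ / 2)) with hK
  set g : ℝ → ℝ := fun θ => (1 - cos (N * θ)) * cos (θ / 2) / (2 * N * sin (θ / 2) ^ 2) with hg
  -- A majorant of `g` which is `5π²/4` times the derivative of `arctan (Nθ)`; the constant is `5/2`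
  -- from `one_sub_cos_mul_le`, `π²` from `sin (θ/2) ≥ θ/π`, and the `1/2` present in `g`.
  set h : ℝ → ℝ := fun θ => 5 * π ^ 2 / 4 * (N / (1 + (N * θ) ^ 2)) with hh
  have hs : ∀ θ ∈ uIcc ε π, 0 < θ ∧ θ ≤ π ∧ 0 < sin (θ / 2) := fun θ hθ => by
    rw [uIcc_of_le h1] at hθ
    exact ⟨h0.trans_le hθ.1, hθ.2, sin_half_pos (h0.trans_le hθ.1) hθ.2⟩
  have hgc : ContinuousOn g (uIcc ε π) := by
    refine ContinuousOn.div (by fun_prop) (by fun_prop) fun θ hθ => ?_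
    have := (hs θ hθ).2.2
    positivity
  have hfc : ContinuousOn (fun θ => sin (N * θ) / sin (θ / 2)) (uIcc ε π) :=
    continuousOn_div_sin_half (by fun_prop) h0 h1
  have hhc : ContinuousOn h (uIcc ε π) := by
    refine ContinuousOn.mul (by fun_prop) (ContinuousOn.div (by fun_prop) (by fun_prop)
      fun θ hθ => ?_)
    positivity
  have hKd : ∀ θ ∈ uIcc ε π, HasDerivAt K (sin (N * θ) / sin (θ / 2) - g θ) θ := by
    intro θ hθ
    have hsp := (hs θ hθ).2.2
    have d1 : HasDerivAt (fun θ : ℝ => 1 - cos (N * θ)) (sin (N * θ) * N) θ := by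
      have := (((hasDerivAt_id θ).const_mul N).cos).const_sub 1
      simpa using this
    have d2 : HasDerivAt (fun θ : ℝ => N * sin (θ / 2)) (N * (cos (θ / 2) * (1 / 2))) θ := by
      have := (((hasDerivAt_id θ).div_const 2).sin).const_mul N
      simpa using this
    refine (d1.div d2 (by positivity)).congr_deriv ?_
    simp only [hg]
    field_simp
  have e1 : ∫ θ in ε..π, (sin (N * θ) / sin (θ / 2) - g θ) = K π - K ε :=
    intervalIntegral.integral_eq_sub_of_hasDerivAt hKd (hfc.sub hgc).intervalIntegrable
  rw [intervalIntegral.integral_sub hfc.intervalIntegrable hgc.intervalIntegrable] at e1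
  have e2 : ∫ θ in ε..π, h θ = 5 * π ^ 2 / 4 * (arctan (N * π) - arctan (N * ε)) := by
    rw [mul_sub]
    refine intervalIntegral.integral_eq_sub_of_hasDerivAt
      (f := fun θ => 5 * π ^ 2 / 4 * arctan (N * θ)) (fun θ _ => ?_) hhc.intervalIntegrable
    have := (((hasDerivAt_id θ).const_mul N).arctan).const_mul (5 * π ^ 2 / 4)
    refine this.congr_deriv ?_
    simp only [hh, id]
    ring
  have hg0 : 0 ≤ ∫ θ in ε..π, g θ := by
    refine intervalIntegral.integral_nonneg h1 fun θ hθ => ?_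
    have hc : 0 ≤ cos (θ / 2) := cos_nonneg_of_mem_Icc
      ⟨by linarith [hθ.1, pi_pos], by linarith [hθ.2]⟩
    exact div_nonneg (mul_nonneg (by linarith [cos_le_one (N * θ)]) hc) (by positivity)
  have hgh : ∫ θ in ε..π, g θ ≤ ∫ θ in ε..π, h θ := by
    refine intervalIntegral.integral_mono_on h1 hgc.intervalIntegrable hhc.intervalIntegrable
      fun θ hθ => ?_
    have hθ0 : 0 < θ := h0.trans_le hθ.1
    have hsl := le_sin_half hθ0.le hθ.2
    have hsp := sin_half_pos hθ0 hθ.2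
    have hA : 0 ≤ 1 - cos (N * θ) := by linarith [cos_le_one (N * θ)]
    have hB := one_sub_cos_mul_le (N * θ)
    have hC : 1 - cos (N * θ) ≤ 5 / 2 * (N * θ) ^ 2 / (1 + (N * θ) ^ 2) := by
      rw [le_div_iff₀ (by positivity)]; exact hB
    calc g θ ≤ (1 - cos (N * θ)) * 1 / (2 * N * (θ / π) ^ 2) := by
          simp only [hg]
          gcongr
          exact cos_le_one _
      _ ≤ (5 / 2 * (N * θ) ^ 2 / (1 + (N * θ) ^ 2)) * 1 / (2 * N * (θ / π) ^ 2) := by gcongr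
      _ = h θ := by
          simp only [hh]
          field_simp
          ring
  have hKb : ∀ θ, 0 < θ → θ ≤ π → 0 ≤ K θ ∧ K θ ≤ π := by
    intro θ hθ0 hθ1
    have hsl := le_sin_half hθ0.le hθ1
    have hsp := sin_half_pos hθ0 hθ1
    refine ⟨div_nonneg (by linarith [cos_le_one (N * θ)]) (by positivity), ?_⟩
    rw [hK]
    simp only
    rw [div_le_iff₀ (by positivity)]
    have h3 := one_sub_cos_le_abs (N * θ)
    rw [abs_of_pos (by positivity)] at h3
    rw [div_le_iff₀ pi_pos] at hsl
    nlinarith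
  have k1 := hKb ε h0 h1
  have k2 := hKb π pi_pos le_rfl
  have a1 := arctan_lt_pi_div_two (N * π)
  have a2 : 0 ≤ arctan (N * ε) := arctan_nonneg.2 (by positivity)
  have a3 : ∫ θ in ε..π, h θ ≤ 5 * π ^ 2 / 4 * (π / 2) := by
    rw [e2]
    exact mul_le_mul_of_nonneg_left (by linarith) (by positivity)
  have e3 : dirichletTail N ε = K π - K ε + ∫ θ in ε..π, g θ := by
    rw [dirichletTail]; linarith
  rw [e3, abs_le]
  constructor <;> linarith [pi_pos]

theorem dirichletTail_neg (N ε : ℝ) : dirichletTail (-N) ε = -dirichletTail N ε := by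
  simp [dirichletTail, neg_div]

/-- The frequency `b - 1/2` never vanishes, and oddness in the frequency reduces `b ≤ 0` to the
positive case. -/
theorem exists_dirichletTail_bound : ∃ C : ℝ, ∀ (b : ℤ) (ε : ℝ), 0 < ε → ε ≤ π →
    |dirichletTail (b - 1 / 2) ε| ≤ C := by
  refine ⟨2 * π + 5 * π ^ 2 / 4 * (π / 2), fun b ε h0 h1 => ?_⟩
  rcases le_or_gt 1 b with hb | hb
  · have : (1 : ℝ) ≤ b := by exact_mod_cast hb
    exact abs_dirichletTail_le_of_pos (by linarith) h0 h1
  · have : (b : ℝ) ≤ 0 := by exact_mod_cast (by omega : b ≤ 0)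
    rw [← abs_neg, ← dirichletTail_neg]
    exact abs_dirichletTail_le_of_pos (by linarith) h0 h1

/-- The principal value of `2 u ^ b / (1 - u)` over the circle. -/
def pvSymbol (b : ℤ) : ℝ := if 0 < b then -1 else 1

/-- From `sin ((b + 1/2)θ) - sin ((b - 1/2)θ) = 2 cos (bθ) sin (θ/2)`. -/
theorem dirichletTail_succ (b : ℤ) {ε : ℝ} (h0 : 0 < ε) (h1 : ε ≤ π) :
    dirichletTail ((b + 1 : ℤ) - 1 / 2) ε
      = dirichletTail (b - 1 / 2) ε + ∫ θ in ε..π, 2 * cos (b * θ) := by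
  have hfc : ∀ N : ℝ, ContinuousOn (fun θ => sin (N * θ) / sin (θ / 2)) (uIcc ε π) := fun N =>
    continuousOn_div_sin_half (by fun_prop) h0 h1
  have hc : Continuous fun θ : ℝ => 2 * cos (b * θ) := by fun_prop
  rw [dirichletTail, dirichletTail, ← intervalIntegral.integral_add (hfc _).intervalIntegrable
    (hc.intervalIntegrable _ _)]
  refine intervalIntegral.integral_congr fun θ hθ => ?_
  rw [uIcc_of_le h1] at hθ
  have hs := (sin_half_pos (h0.trans_le hθ.1) hθ.2).ne'
  have e1 : ((b + 1 : ℤ) - 1 / 2 : ℝ) * θ = b * θ + θ / 2 := by push_cast; ring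
  have e2 : ((b : ℝ) - 1 / 2) * θ = b * θ - θ / 2 := by ring
  simp only [e1, e2, sin_add, sin_sub]
  field_simp
  ring

theorem tendsto_integral_two_cos (b : ℤ) :
    Tendsto (fun ε => ∫ θ in ε..π, 2 * cos (b * θ)) (𝓝[>] 0) (𝓝 (if b = 0 then 2 * π else 0)) := by
  have hc : Continuous fun θ : ℝ => 2 * cos (b * θ) := by fun_prop
  have h1 : Continuous fun ε : ℝ => ∫ θ in ε..π, 2 * cos (b * θ) := by
    have h2 := intervalIntegral.continuous_primitive (μ := volume)
      (fun a c => hc.intervalIntegrable a c) π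
    have h3 : (fun ε : ℝ => ∫ θ in ε..π, 2 * cos (b * θ))
        = fun ε => -∫ θ in π..ε, 2 * cos (b * θ) := by
      funext ε; rw [intervalIntegral.integral_symm]
    rw [h3]
    exact h2.neg
  have h2 := (h1.tendsto 0).mono_left (nhdsWithin_le_nhds (s := Ioi 0))
  convert h2 using 2
  split_ifs with hb
  · simp [hb]; ring
  · have hb' : (b : ℝ) ≠ 0 := by exact_mod_cast hb
    rw [intervalIntegral.integral_const_mul, intervalIntegral.integral_comp_mul_left _ hb']
    simp [Real.sin_int_mul_pi]

/-- At `b = 0` the integrand is `-1`. Passing from `b` to `b + 1` adds the integral of `2 cos (bθ)`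
over `[0, π]`, which is `2π` for `b = 0` and zero otherwise: the only sign change occurs between `b
= 0` and `b = 1`. -/
theorem tendsto_dirichletTail (b : ℤ) :
    Tendsto (dirichletTail (b - 1 / 2)) (𝓝[>] 0) (𝓝 (-π * pvSymbol b)) := by
  have hev : ∀ᶠ ε : ℝ in 𝓝[>] 0, 0 < ε ∧ ε ≤ π := by
    filter_upwards [Ioc_mem_nhdsGT pi_pos] with ε hε using hε
  have hstep : ∀ b : ℤ, (fun ε => dirichletTail ((b + 1 : ℤ) - 1 / 2) ε) =ᶠ[𝓝[>] 0]
      fun ε => dirichletTail (b - 1 / 2) ε + ∫ θ in ε..π, 2 * cos (b * θ) := fun b => by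
    filter_upwards [hev] with ε hε using dirichletTail_succ b hε.1 hε.2
  have hsym : ∀ b : ℤ, -π * pvSymbol (b + 1) = -π * pvSymbol b + if b = 0 then 2 * π else 0 := by
    intro b
    unfold pvSymbol
    split_ifs <;> first | omega | ring
  have hzero : Tendsto (dirichletTail ((0 : ℤ) - 1 / 2)) (𝓝[>] 0) (𝓝 (-π * pvSymbol 0)) := by
    have h1 : (fun ε : ℝ => ε - π) =ᶠ[𝓝[>] 0] dirichletTail ((0 : ℤ) - 1 / 2) := by
      filter_upwards [hev] with ε hε
      have : dirichletTail ((0 : ℤ) - 1 / 2) ε = ∫ θ in ε..π, (-1 : ℝ) := by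
        refine intervalIntegral.integral_congr fun θ hθ => ?_
        rw [uIcc_of_le hε.2] at hθ
        have hs := (sin_half_pos (hε.1.trans_le hθ.1) hθ.2).ne'
        have e : ((0 : ℤ) - 1 / 2 : ℝ) * θ = -(θ / 2) := by push_cast; ring
        simp only [e, sin_neg, neg_div, div_self hs]
      rw [this]; simp
    refine Tendsto.congr' h1 ?_
    have h2 : Tendsto (fun ε : ℝ => ε - π) (𝓝 0) (𝓝 (0 - π)) := tendsto_id.sub_const π
    simpa [pvSymbol] using h2.mono_left nhdsWithin_le_nhds
  induction b using Int.induction_on with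
  | zero => exact hzero
  | succ k ih =>
    rw [hsym]
    exact (ih.add (tendsto_integral_two_cos k)).congr' (hstep k).symm
  | pred k ih =>
    have h1 := hsym (-k - 1)
    have h2 := hstep (-k - 1)
    rw [sub_add_cancel] at h1 h2
    have h3 := (ih.congr' h2).sub (tendsto_integral_two_cos (-k - 1))
    rw [h1, add_sub_cancel_right] at h3
    simpa using h3


/-! ### Principal values against `2 / (1 - u)`. -/

/-- The truncated circle `{θ | ε < |θ| ≤ π}`. -/
def tailSet (ε : ℝ) : Set ℝ := {θ | ε < |θ| ∧ |θ| ≤ π}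

theorem measurableSet_tailSet (ε : ℝ) : MeasurableSet (tailSet ε) :=
  (measurableSet_lt measurable_const measurable_norm).inter
    (measurableSet_le measurable_norm measurable_const)

theorem tailSet_eq {ε : ℝ} (h0 : 0 < ε) : tailSet ε = Ioc ε π ∪ Ico (-π) (-ε) := by
  ext θ
  simp only [tailSet, mem_ofPred_eq, mem_union, mem_Ioc, mem_Ico]
  rcases le_total 0 θ with h | h
  · rw [abs_of_nonneg h]
    constructor
    · exact fun H => Or.inl H
    · rintro (H | H)
      · exact H
      · exact absurd H.2 (by linarith)
  · rw [abs_of_nonpos h]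
    constructor
    · exact fun H => Or.inr ⟨by linarith [H.2], by linarith [H.1]⟩
    · rintro (H | H)
      · exact absurd H.1 (by linarith)
      · exact ⟨by linarith [H.2], by linarith [H.1]⟩

/-- The function `2 / (1 - u)`, with `u = exp (i θ)`. -/
def cauchyKernel (θ : ℝ) : ℂ := 2 / (1 - Complex.exp (θ * Complex.I))

theorem one_sub_exp_ne_zero {θ : ℝ} (h0 : θ ≠ 0) (h1 : |θ| ≤ π) :
    1 - Complex.exp (θ * Complex.I) ≠ 0 := by
  intro h
  have h2 : Complex.exp (θ * Complex.I) = 1 := (sub_eq_zero.1 h).symm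
  have h3 := congrArg Complex.re h2
  rw [Complex.exp_ofReal_mul_I_re, Complex.one_re] at h3
  have h4 := abs_le.1 h1
  exact h0 ((Real.cos_eq_one_iff_of_lt_of_lt (by linarith [pi_pos]) (by linarith [pi_pos])).1 h3)

theorem continuousOn_cauchyKernel {ε : ℝ} (h0 : 0 < ε) :
    ContinuousOn cauchyKernel {θ : ℝ | ε ≤ |θ| ∧ |θ| ≤ π} := by
  refine continuousOn_const.div (by fun_prop) fun θ hθ => ?_
  exact one_sub_exp_ne_zero (abs_pos.1 (h0.trans_le hθ.1)) hθ.2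

theorem isCompact_closedTail (ε : ℝ) : IsCompact {θ : ℝ | ε ≤ |θ| ∧ |θ| ≤ π} := by
  refine Metric.isCompact_of_isClosed_isBounded ?_ ?_
  · exact (isClosed_le continuous_const continuous_abs).inter
      (isClosed_le continuous_abs continuous_const)
  · exact (Metric.isBounded_closedBall (x := (0 : ℝ)) (r := π)).subset fun θ hθ => by
      simpa using hθ.2

theorem integrableOn_tailSet {E : Type*} [NormedAddCommGroup E] {ε : ℝ} {f : ℝ → E}
    (hf : ContinuousOn f {θ : ℝ | ε ≤ |θ| ∧ |θ| ≤ π}) : IntegrableOn f (tailSet ε) :=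
  (hf.integrableOn_compact (isCompact_closedTail ε)).mono_set fun _ hθ => ⟨hθ.1.le, hθ.2⟩

theorem integrableOn_cauchyKernel_mul {ε : ℝ} (h0 : 0 < ε) {f : ℝ → ℂ} (hf : Continuous f) :
    IntegrableOn (fun θ => cauchyKernel θ * f θ) (tailSet ε) :=
  integrableOn_tailSet ((continuousOn_cauchyKernel h0).mul hf.continuousOn)

theorem integral_tailSet {ε : ℝ} (h0 : 0 < ε) (h1 : ε ≤ π) {f : ℝ → ℂ}
    (hf : IntegrableOn f (tailSet ε)) :
    ∫ θ in tailSet ε, f θ = ∫ θ in ε..π, (f θ + f (-θ)) := by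
  rw [tailSet_eq h0] at hf ⊢
  have hl := hf.left_of_union
  have hr := hf.right_of_union
  have i1 : IntervalIntegrable f volume ε π := (intervalIntegrable_iff_integrableOn_Ioc_of_le h1).2 hl
  have i2 : IntervalIntegrable f volume (-π) (-ε) := by
    rw [intervalIntegrable_iff_integrableOn_Ioc_of_le (by linarith)]
    exact ((integrableOn_Icc_iff_integrableOn_Ico (by simp)).2 hr).mono_set Ioc_subset_Icc_self
  have i3 : IntervalIntegrable (fun θ => f (-θ)) volume ε π := by
    have := (i2.comp_sub_left 0).symm
    simpa using this
  rw [setIntegral_union _ measurableSet_Ico hl hr, intervalIntegral.integral_add i1 i3,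
    intervalIntegral.integral_comp_neg, intervalIntegral.integral_of_le h1,
    intervalIntegral.integral_of_le (by linarith), ← integral_Icc_eq_integral_Ico,
    ← integral_Icc_eq_integral_Ioc (x := -π)]
  rw [Set.disjoint_left]
  intro θ hθ hθ'
  linarith [hθ.1, hθ'.2]

/-- The truncation is symmetric, so `θ` and `-θ` may be paired. Since `2 u^b / (1 - u) = i exp (i(b
- 1/2)θ) / sin (θ/2)`, the pair adds up to twice the real part and the odd singular imaginary part
cancels. -/
theorem integral_cauchyKernel_mul_exp (b : ℤ) {ε : ℝ} (h0 : 0 < ε) (h1 : ε ≤ π) :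
    ∫ θ in tailSet ε, cauchyKernel θ * Complex.exp (b * θ * Complex.I)
      = ((-2 * dirichletTail (b - 1 / 2) ε : ℝ) : ℂ) := by
  rw [integral_tailSet h0 h1 (integrableOn_cauchyKernel_mul h0 (by fun_prop)), dirichletTail,
    ← intervalIntegral.integral_const_mul, ← intervalIntegral.integral_ofReal]
  refine intervalIntegral.integral_congr fun θ hθ => ?_
  rw [uIcc_of_le h1] at hθ
  have hθ0 := h0.trans_le hθ.1
  have hs := (sin_half_pos hθ0 hθ.2).ne'
  have n1 := one_sub_exp_ne_zero hθ0.ne' (by rw [abs_of_pos hθ0]; exact hθ.2)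
  have n2 := one_sub_exp_ne_zero (θ := -θ) (neg_ne_zero.2 hθ0.ne')
    (by rw [abs_neg, abs_of_pos hθ0]; exact hθ.2)
  have hs' : Complex.sin ((θ : ℂ) / 2) ≠ 0 := by
    have := Complex.ofReal_ne_zero.2 hs
    push_cast at this
    exact this
  simp only [cauchyKernel]
  push_cast at n2 ⊢
  -- With `w = exp (iθ/2)` and `z = exp (ibθ)` the claim becomes an identity of rational functions.
  set w := Complex.exp ((θ : ℂ) / 2 * Complex.I) with hw
  have hw0 : w ≠ 0 := Complex.exp_ne_zero _
  have e1 : Complex.exp (θ * Complex.I) = w ^ 2 := by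
    rw [hw, ← Complex.exp_nat_mul]; congr 1; push_cast; ring
  have e2 : Complex.exp (-θ * Complex.I) = (w ^ 2)⁻¹ := by
    rw [← e1, ← Complex.exp_neg]; congr 1; ring
  set z := Complex.exp ((b : ℂ) * θ * Complex.I) with hz
  have hz0 : z ≠ 0 := Complex.exp_ne_zero _
  have e3 : Complex.exp ((b : ℂ) * -θ * Complex.I) = z⁻¹ := by
    rw [hz, ← Complex.exp_neg]; congr 1; ring
  have e4 : Complex.sin ((θ : ℂ) / 2) = (w⁻¹ - w) * Complex.I / 2 := by
    rw [Complex.sin, hw, ← Complex.exp_neg]; congr 4; ring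
  have e5 : Complex.sin (((b : ℂ) - 1 / 2) * θ) = (w / z - z / w) * Complex.I / 2 := by
    rw [Complex.sin, hw, hz, ← Complex.exp_sub, ← Complex.exp_sub]
    congr 4 <;> ring
  rw [e4] at hs' ⊢
  rw [e1] at n1 ⊢
  rw [e2] at n2 ⊢
  rw [e3, e5]
  have n3 : w⁻¹ - w ≠ 0 := by
    intro h; apply hs'; rw [h]; ring
  have n4 : w ^ 2 - 1 ≠ 0 := by
    intro h; apply n1; linear_combination -h
  have n5 : (1 - (w ^ 2)⁻¹) = (w ^ 2 - 1) / w ^ 2 := by field_simp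
  have n6 : w⁻¹ - w = (1 - w ^ 2) / w := by field_simp
  rw [n5, n6]
  have hI := Complex.I_ne_zero
  have n7 : w ^ 2 - 1 = -(1 - w ^ 2) := by ring
  rw [n7]
  field_simp
  ring

/-- For fixed `ε` the kernel is integrable on the truncated circle, so sum and integral commute. The
uniform bound on Dirichlet tails then gives dominated convergence of the series as `ε → 0`. -/
theorem tendsto_pv {ι : Type*} [Countable ι] (c : ι → ℂ) (k : ι → ℤ)
    (hc : Summable fun j => ‖c j‖) :
    Tendsto (fun ε => (2 * π)⁻¹ * ∫ θ in tailSet ε,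
        cauchyKernel θ * ∑' j, c j * Complex.exp (k j * θ * Complex.I)) (𝓝[>] 0)
      (𝓝 (∑' j, c j * pvSymbol (k j))) := by
  obtain ⟨C, hC⟩ := exists_dirichletTail_bound
  have hev : ∀ᶠ ε : ℝ in 𝓝[>] 0, 0 < ε ∧ ε ≤ π := by
    filter_upwards [Ioc_mem_nhdsGT pi_pos] with ε hε using hε
  have hπ : (π : ℂ) ≠ 0 := Complex.ofReal_ne_zero.2 pi_ne_zero
  have hval : ∀ᶠ ε : ℝ in 𝓝[>] 0,
      ∑' j, c j * ((-π⁻¹ * dirichletTail (k j - 1 / 2) ε : ℝ) : ℂ) =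
        (2 * π)⁻¹ * ∫ θ in tailSet ε,
          cauchyKernel θ * ∑' j, c j * Complex.exp (k j * θ * Complex.I) := by
    filter_upwards [hev] with ε hε
    have hint : ∀ j, IntegrableOn
        (fun θ => cauchyKernel θ * (c j * Complex.exp (k j * θ * Complex.I))) (tailSet ε) :=
      fun j => integrableOn_cauchyKernel_mul hε.1 (by fun_prop)
    have hnorm : ∀ j θ, ‖cauchyKernel θ * (c j * Complex.exp (k j * θ * Complex.I))‖
        ≤ ‖c j‖ * ‖cauchyKernel θ‖ := by
      intro j θ
      rw [norm_mul, norm_mul, mul_comm]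
      exact mul_le_mul_of_nonneg_right
        (mul_le_of_le_one_right (norm_nonneg _) (Wiener.norm_exp_int _ _)) (norm_nonneg _)
    have hq : IntegrableOn cauchyKernel (tailSet ε) := by
      simpa using integrableOn_cauchyKernel_mul hε.1 (continuous_const (y := (1 : ℂ)))
    have hsum : Summable fun j => ∫ θ in tailSet ε,
        ‖cauchyKernel θ * (c j * Complex.exp (k j * θ * Complex.I))‖ := by
      refine Summable.of_nonneg_of_le (fun j => integral_nonneg fun _ => norm_nonneg _)
        (fun j => ?_) (hc.mul_right (∫ θ in tailSet ε, ‖cauchyKernel θ‖))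
      rw [← integral_const_mul]
      exact integral_mono (hint j).norm (hq.norm.const_mul _) (hnorm j)
    have h := hasSum_integral_of_summable_integral_norm hint hsum
    have h2 : ∫ θ in tailSet ε, cauchyKernel θ * ∑' j, c j * Complex.exp (k j * θ * Complex.I)
        = ∑' j, c j * ((-2 * dirichletTail (k j - 1 / 2) ε : ℝ) : ℂ) := by
      simp only [← tsum_mul_left]
      rw [← h.tsum_eq]
      refine tsum_congr fun j => ?_
      rw [← integral_cauchyKernel_mul_exp _ hε.1 hε.2, ← integral_const_mul]
      congr 1
      funext θ
      ring
    rw [h2, ← tsum_mul_left]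
    refine tsum_congr fun j => ?_
    push_cast
    field_simp
  refine Tendsto.congr' hval ?_
  refine tendsto_tsum_of_dominated_convergence (bound := fun j => ‖c j‖ * (π⁻¹ * C))
    (hc.mul_right _) (fun j => ?_) ?_
  · refine Tendsto.const_mul _ ?_
    refine (Complex.continuous_ofReal.tendsto _).comp ?_
    have := (tendsto_dirichletTail (k j)).const_mul (-π⁻¹)
    convert this using 2
    field_simp
  · filter_upwards [hev] with ε hε j
    rw [norm_mul, Complex.norm_real, norm_mul, norm_neg, norm_of_nonneg (inv_nonneg.2 pi_pos.le)]
    exact mul_le_mul_of_nonneg_left (mul_le_mul_of_nonneg_left (hC _ _ hε.1 hε.2)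
      (inv_nonneg.2 pi_pos.le)) (norm_nonneg _)

namespace Wiener

/-- The principal value of `2 f(u) / (1 - u)` over the circle. -/
def pv : Wiener →L[ℝ] ℂ := lift (fun k => (pvSymbol k : ℂ)) fun k => by
  unfold pvSymbol; split_ifs <;> simp

end Wiener

namespace TorusSeries

variable {t : ℝ}

theorem summable_coeff (ht : 1 < t) (m : ℕ) (x : ℝ) (v : TorusSeries) :
    Summable fun p : ℤ × ℤ => ‖waveCoeff m t x p.1 * (v p.1 p.2 : ℂ)‖ := by
  have hn : ∀ n k, ‖waveCoeff m t x n * (v n k : ℂ)‖ = (wt t n)⁻¹ * ‖v n k‖ := fun n k => by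
    rw [norm_mul, norm_waveCoeff, Complex.norm_real]
  rw [summable_prod_of_nonneg fun _ => norm_nonneg _]
  simp only [hn]
  refine ⟨fun n => (v n).hasSum_norm.summable.mul_left _, ?_⟩
  simp only [tsum_mul_left, (Wiener.hasSum_norm _).tsum_eq]
  refine Summable.of_nonneg_of_le (fun n => ?_) (fun n => ?_) ((summable_inv_wt ht).mul_right ‖v‖)
  · exact mul_nonneg (inv_nonneg.2 (wt_pos t n).le) (norm_nonneg _)
  · exact mul_le_mul_of_nonneg_left (norm_apply_le v n) (inv_nonneg.2 (wt_pos t n).le)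

/-- Writes evaluation in `θ` and the principal value as the same double series over `(n, k)`, with
different symbols in `k`; `tendsto_pv` passes from one to the other. -/
theorem evalWith_lift (ht : 1 < t) (m : ℕ) (x : ℝ) (z : ℤ → ℂ) (hz : ∀ k, ‖z k‖ ≤ 1)
    (v : TorusSeries) : evalWith m t x (Wiener.lift z hz) v
      = ∑' p : ℤ × ℤ, waveCoeff m t x p.1 * (v p.1 p.2 : ℂ) * z p.2 := by
  have hs : Summable fun p : ℤ × ℤ => waveCoeff m t x p.1 * (v p.1 p.2 : ℂ) * z p.2 := by
    refine Summable.of_norm (Summable.of_nonneg_of_le (fun _ => norm_nonneg _) (fun p => ?_)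
      (summable_coeff ht m x v))
    rw [norm_mul]
    exact mul_le_of_le_one_right (norm_nonneg _) (hz _)
  rw [hs.tsum_prod, ← (hasSum_evalWith ht m x _ v).tsum_eq]
  refine tsum_congr fun n => ?_
  rw [Wiener.lift_apply, ← tsum_mul_left]
  refine tsum_congr fun k => ?_
  rw [Complex.real_smul, mul_assoc]

theorem tendsto_pv_ev (ht : 1 < t) (m : ℕ) (x : ℝ) (v : TorusSeries) :
    Tendsto (fun ε => (2 * π)⁻¹ * ∫ θ in tailSet ε, cauchyKernel θ * ev m t x θ v) (𝓝[>] 0)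
      (𝓝 (evalWith m t x Wiener.pv v)) := by
  have h := tendsto_pv (fun p : ℤ × ℤ => waveCoeff m t x p.1 * (v p.1 p.2 : ℂ)) (fun p => p.2)
    (summable_coeff ht m x v)
  have h1 := evalWith_lift ht m x (fun k => (pvSymbol k : ℂ)) (fun k => by
    unfold pvSymbol; split_ifs <;> simp) v
  have h2 : ∀ θ, ev m t x θ v = _ := fun θ => evalWith_lift ht m x _ _ v
  rw [← h1] at h
  simp only [h2]
  exact h

theorem continuous_ev (ht : 1 < t) (m : ℕ) (x : ℝ) (v : TorusSeries) :
    Continuous fun θ => ev m t x θ v := by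
  have h2 : ∀ θ, ev m t x θ v = _ := fun θ => evalWith_lift ht m x _ _ v
  simp only [h2]
  refine continuous_tsum (fun p => by fun_prop) (summable_coeff ht m x v) fun p θ => ?_
  rw [norm_mul]
  exact mul_le_of_le_one_right (norm_nonneg _) (Wiener.norm_exp_int _ _)

/-- The principal value, as an operator into functions independent of `θ`. -/
def pvOp : TorusSeries →L[ℝ] TorusSeries :=
  lp.mapCLM 2 (fun _ => Wiener.lift (fun k => pvSymbol k • Wiener.mono 0) fun k => by
    rw [norm_smul, Wiener.norm_mono, pvSymbol]; split_ifs <;> simp) zero_le_one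
    fun _ => Wiener.norm_lift_le _ _

theorem ev_pvOp (ht : 1 < t) (m : ℕ) (x θ : ℝ) (v : TorusSeries) :
    ev m t x θ (pvOp v) = evalWith m t x Wiener.pv v := by
  refine (hasSum_evalWith ht m x _ _).unique ?_
  refine (hasSum_evalWith ht m x _ v).congr_fun fun n => ?_
  congr 1
  have h : pvOp v n = Wiener.lift (fun k => pvSymbol k • Wiener.mono 0) (fun k => by
    rw [norm_smul, Wiener.norm_mono, pvSymbol]; split_ifs <;> simp) (v n) := rfl
  rw [h]
  refine ((Wiener.hasSum_lift _ _ (v n)).mapL (Wiener.eval θ)).unique ?_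
  refine (Wiener.hasSum_lift _ _ (v n)).congr_fun fun k => ?_
  rw [map_smul, map_smul, Wiener.eval_mono]
  simp

end TorusSeries


/-! ### Square roots, reciprocals and the regular kernel near zero. -/

namespace TorusSeries

variable {t : ℝ}

/-- Since `(1 + v)² = 1 + 2 (v + v²/2)`, the map `S` is the local inverse of `v ↦ v + v²/2`, whose
derivative at zero is the identity. The bound by `1/2` serves to select the positive square root. -/
theorem exists_sqrt (ht : 1 < t) (m : ℕ) :
    ∃ S : TorusSeries → TorusSeries, S 0 = 0 ∧ ContDiffAt ℝ 1 S 0 ∧ ∀ᶠ a in 𝓝 0, ∀ x θ,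
      (1 + ev m t x θ (S a)) ^ 2 = 1 + 2 * ev m t x θ a ∧ ‖ev m t x θ (S a)‖ ≤ 1 / 2 := by
  set f : TorusSeries → TorusSeries := fun v => v + (1 / 2 : ℝ) • mul ht v v with hf
  have hfc : ContDiff ℝ 1 f :=
    contDiff_id.add (((mul ht).contDiff.clm_apply contDiff_id).const_smul _)
  have hf0 : f 0 = 0 := by simp [hf]
  have hd : HasFDerivAt f ((ContinuousLinearEquiv.refl ℝ TorusSeries :
      TorusSeries ≃L[ℝ] TorusSeries) : TorusSeries →L[ℝ] TorusSeries) 0 := by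
    have h1 : HasFDerivAt (fun v => mul ht v v) (0 : TorusSeries →L[ℝ] TorusSeries) 0 := by
      have := (mul ht).hasFDerivAt (x := 0).clm_apply (hasFDerivAt_id (0 : TorusSeries))
      refine this.congr_fderiv ?_
      ext1 v
      simp
    refine ((hasFDerivAt_id (0 : TorusSeries)).add (h1.const_smul (1 / 2 : ℝ))).congr_fderiv ?_
    ext1 v
    simp
  have hcd : ContDiffAt ℝ 1 f 0 := hfc.contDiffAt
  have hn : (1 : WithTop ℕ∞) ≠ 0 := one_ne_zero
  have hS := hcd.to_localInverse hd hn
  have hr := (hcd.hasStrictFDerivAt' hd hn).eventually_right_inverse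
  have hS0 : hcd.localInverse hd hn 0 = 0 := by
    have := hcd.localInverse_apply_image hd hn
    rwa [hf0] at this
  rw [hf0] at hS hr
  refine ⟨hcd.localInverse hd hn, hS0, hS, ?_⟩
  obtain ⟨C, hC⟩ := exists_ev_bound ht m
  have hsm : ∀ᶠ a in 𝓝 (0 : TorusSeries), C * ‖hcd.localInverse hd hn a‖ < 1 / 2 := by
    have h1 : Tendsto (fun a => C * ‖hcd.localInverse hd hn a‖) (𝓝 0) (𝓝 (C * ‖(0 : TorusSeries)‖)) := by
      have := hS.continuousAt.tendsto
      rw [hS0] at this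
      exact this.norm.const_mul C
    refine h1.eventually_lt_const ?_
    simp
  filter_upwards [hr, hsm] with a ha hb x θ
  refine ⟨?_, (hC x θ _).trans hb.le⟩
  have h1 := congrArg (ev m t x θ) ha
  simp only [hf, map_add, map_smul, ev_mul, Complex.real_smul] at h1
  push_cast at h1
  change _ = ev m t x θ a at h1
  rw [← h1]
  have e : ∀ z : ℂ, (1 + z) ^ 2 = 1 + 2 * (z + 1 / 2 * (z * z)) := fun z => by ring
  exact e _

/-- The operator `1 + (multiplication by a)` is invertible for small `a`, and the inverse operator
applied to `one` is the reciprocal. Working with operators requires no ring structure on the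
function space. -/
theorem exists_inv (ht : 1 < t) (m : ℕ) :
    ∃ I : TorusSeries → TorusSeries, I 0 = 0 ∧ ContDiffAt ℝ 1 I 0 ∧ ∀ᶠ a in 𝓝 0, ∀ x θ,
      (1 + ev m t x θ (I a)) * (1 + ev m t x θ a) = 1 := by
  set g : TorusSeries → (TorusSeries →L[ℝ] TorusSeries) := fun a => 1 + mul ht a with hg
  have hgc : ContDiff ℝ 1 g := contDiff_const.add (mul ht).contDiff
  have hg0 : g 0 = 1 := by simp [hg]
  have hinv : ContDiffAt ℝ 1 (fun a => Ring.inverse (g a)) 0 := by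
    have h1 : ContDiffAt ℝ 1 (Ring.inverse : (TorusSeries →L[ℝ] TorusSeries) → _) (g 0) := by
      rw [hg0]
      exact contDiffAt_ringInverse ℝ (1 : (TorusSeries →L[ℝ] TorusSeries)ˣ)
    exact h1.comp (0 : TorusSeries) hgc.contDiffAt
  refine ⟨fun a => Ring.inverse (g a) one - one, ?_, ?_, ?_⟩
  · simp [hg0]
  · exact (hinv.clm_apply contDiffAt_const).sub contDiffAt_const
  · have hu : ∀ᶠ a in 𝓝 (0 : TorusSeries), IsUnit (g a) := by
      have h1 : Tendsto g (𝓝 0) (𝓝 1) := by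
        have := hgc.continuous.tendsto 0
        rwa [hg0] at this
      exact h1 (Units.isOpen.mem_nhds isUnit_one)
    filter_upwards [hu] with a ha x θ
    have h1 : g a (Ring.inverse (g a) one) = one := by
      have := Ring.mul_inverse_cancel _ ha
      exact congrArg (fun T : TorusSeries →L[ℝ] TorusSeries => T one) this
    have h2 := congrArg (ev m t x θ) h1
    simp only [hg, add_apply, one_apply_eq_self, map_add, ev_mul,
      ev_one ht] at h2
    rw [map_sub, ev_one ht]
    linear_combination h2

variable {H : Type*} [NormedAddCommGroup H] [NormedSpace ℝ H]

/-- `C¹` at the origin, with value zero there. -/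
def IsSmallGerm (f : H → TorusSeries) : Prop := f 0 = 0 ∧ ContDiffAt ℝ 1 f 0

namespace IsSmallGerm

theorem of_clm (L : H →L[ℝ] TorusSeries) : IsSmallGerm L := ⟨map_zero L, L.contDiff.contDiffAt⟩

theorem add {f g : H → TorusSeries} (hf : IsSmallGerm f) (hg : IsSmallGerm g) :
    IsSmallGerm fun h => f h + g h := ⟨by simp [hf.1, hg.1], hf.2.add hg.2⟩

theorem const_smul {f : H → TorusSeries} (c : ℝ) (hf : IsSmallGerm f) :
    IsSmallGerm fun h => c • f h := ⟨by simp [hf.1], hf.2.const_smul c⟩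

theorem mul_left (ht : 1 < t) {f g : H → TorusSeries} (hf : IsSmallGerm f)
    (hg : ContDiffAt ℝ 1 g 0) : IsSmallGerm fun h => mul ht (f h) (g h) :=
  ⟨by simp [hf.1], ((mul ht).contDiff.contDiffAt.comp _ hf.2).clm_apply hg⟩

theorem comp {S : TorusSeries → TorusSeries} (hS : S 0 = 0) (hSc : ContDiffAt ℝ 1 S 0)
    {f : H → TorusSeries} (hf : IsSmallGerm f) : IsSmallGerm fun h => S (f h) := by
  refine ⟨by simp [hf.1, hS], ContDiffAt.comp (0 : H) ?_ hf.2⟩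
  rwa [hf.1]

theorem tendsto {f : H → TorusSeries} (hf : IsSmallGerm f) : Tendsto f (𝓝 0) (𝓝 0) := by
  have := hf.2.continuousAt.tendsto
  rwa [hf.1] at this

end IsSmallGerm

/-- Here `X`, `Y` stand for `η(x)`, `η(x + θ)`, `P` for `u (η(x) - η(x + θ)) / (1 - u)`, and `D` for
`i η_x`; hence the minus sign in `τ² = R² + (η_x/R)²`. The outputs are `R`, `Q = 1/R`, `G = (1 -
u)/(a - u b)` and `W = 1/τ`. -/
theorem exists_profile (ht : 1 < t) (m : ℕ) (X Y P D : H →L[ℝ] TorusSeries) :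
    ∃ R Q G W : H → TorusSeries, ∀ᶠ h in 𝓝 0,
      (ContDiffAt ℝ 1 R h ∧ ContDiffAt ℝ 1 Q h ∧ ContDiffAt ℝ 1 G h ∧ ContDiffAt ℝ 1 W h) ∧
      ∀ x θ, ∃ ρ τ : ℂ,
        (ev m t x θ (R h) ^ 2 = 1 + 2 * ev m t x θ (X h) ∧ ‖ev m t x θ (R h) - 1‖ ≤ 1 / 2) ∧
        (ρ ^ 2 = 1 + 2 * ev m t x θ (Y h) ∧ ‖ρ - 1‖ ≤ 1 / 2) ∧
        (τ ^ 2 = 1 + 2 * ev m t x θ (X h) - (ev m t x θ (D h) * ev m t x θ (Q h)) ^ 2 ∧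
          ‖τ - 1‖ ≤ 1 / 2) ∧
        ev m t x θ (Q h) * ev m t x θ (R h) = 1 ∧
        ev m t x θ (W h) * τ = 1 ∧
        ∀ u : ℂ, (1 - u) * ev m t x θ (P h) = u * (ev m t x θ (X h) - ev m t x θ (Y h)) →
          ev m t x θ (G h) * (ev m t x θ (R h) - u * ρ) = 1 - u := by
  obtain ⟨S, S0, Sc, hS⟩ := exists_sqrt ht m
  obtain ⟨I, I0, Ic, hI⟩ := exists_inv ht m
  have gX := IsSmallGerm.of_clm X
  have gSX := gX.comp S0 Sc
  have gSY := (IsSmallGerm.of_clm Y).comp S0 Sc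
  have gISX := gSX.comp I0 Ic
  have gM0 := (gSX.add gSY).const_smul (1 / 2)
  have gM := gM0.comp I0 Ic
  -- This function is `2 / (R(x) + R(y))`, the reciprocal of a mean of the two radii.
  have cM : ContDiffAt ℝ 1 (fun h => one + I ((1 / 2 : ℝ) • (S (X h) + S (Y h)))) 0 :=
    contDiffAt_const.add gM.2
  have gG0 := gSX.add ((IsSmallGerm.of_clm P).mul_left ht cM)
  have gG := gG0.comp I0 Ic
  have cQ : ContDiffAt ℝ 1 (fun h => one + I (S (X h))) 0 := contDiffAt_const.add gISX.2
  have gDQ := (IsSmallGerm.of_clm D).mul_left ht cQ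
  have gτ := gX.add ((gDQ.mul_left ht gDQ.2).const_smul (-(1 / 2)))
  have gSτ := gτ.comp S0 Sc
  have gW := gSτ.comp I0 Ic
  refine ⟨fun h => one + S (X h), fun h => one + I (S (X h)),
    fun h => one + I (S (X h) + mul ht (P h) (one + I ((1 / 2 : ℝ) • (S (X h) + S (Y h))))),
    fun h => one + I (S (X h + (-(1 / 2) : ℝ) •
      mul ht (mul ht (D h) (one + I (S (X h)))) (mul ht (D h) (one + I (S (X h)))))), ?_⟩
  have c1 : ContDiffAt ℝ 1 (fun h => one + S (X h)) 0 := contDiffAt_const.add gSX.2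
  have c2 := (contDiffAt_const (c := one)).add gG.2
  have c3 := (contDiffAt_const (c := one)).add gW.2
  -- Finite order of differentiability is what makes `ContDiffAt` at zero persist at nearby points.
  have hn : (1 : WithTop ℕ∞) ≠ ((⊤ : ℕ∞) : WithTop ℕ∞) := by simp
  filter_upwards [c1.eventually hn, cQ.eventually hn, c2.eventually hn, c3.eventually hn,
    gX.tendsto.eventually hS, (IsSmallGerm.of_clm Y).tendsto.eventually hS,
    gτ.tendsto.eventually hS, gSX.tendsto.eventually hI, gM0.tendsto.eventually hI,
    gG0.tendsto.eventually hI, gSτ.tendsto.eventually hI] with h k1 k2 k3 k4 a1 a2 a3 b1 b2 b3 b4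
  refine ⟨⟨k1, k2, k3, k4⟩, fun x θ => ⟨1 + ev m t x θ (S (Y h)), 1 + ev m t x θ (S (X h +
    (-(1 / 2) : ℝ) • mul ht (mul ht (D h) (one + I (S (X h)))) (mul ht (D h) (one + I (S (X h)))))),
    ?_⟩⟩
  have b1 := b1 x θ
  have b2 := b2 x θ
  have b3 := b3 x θ
  have b4 := b4 x θ
  obtain ⟨a1, a1'⟩ := a1 x θ
  obtain ⟨a2, a2'⟩ := a2 x θ
  obtain ⟨a3, a3'⟩ := a3 x θ
  have eadd : ∀ a b, ev m t x θ (a + b) = ev m t x θ a + ev m t x θ b := map_add _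
  have esmul : ∀ (c : ℝ) a, ev m t x θ (c • a) = c * ev m t x θ a := fun c a => by
    rw [map_smul, Complex.real_smul]
  simp only [eadd, esmul, ev_one ht, ev_mul, add_sub_cancel_left]
    at b1 b2 b3 b4 a1 a2 a3 ⊢
  push_cast at b2 a3
  refine ⟨⟨a1, a1'⟩, ⟨a2, a2'⟩, ⟨?_, a3'⟩, b1, b4, fun u hu => ?_⟩
  · rw [a3]; ring
  · set r := ev m t x θ (S (X h))
    set r' := ev m t x θ (S (Y h))
    set M := ev m t x θ (I ((1 / 2 : ℝ) • (S (X h) + S (Y h))))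
    set p := ev m t x θ (P h)
    set G := ev m t x θ (I (S (X h) + mul ht (P h) (one + I ((1 / 2 : ℝ) • (S (X h) + S (Y h))))))
    -- Subtracting `a2` from `a1` and using `b2` gives `(X - Y)(1 + M) = r - r'`, so `(1 - u) p (1 +
    -- M) = u (r - r')`.
    have e : (1 - u) * (1 + (r + p * (1 + M))) = 1 + r - u * (1 + r') := by
      linear_combination (1 + M) * hu - (1 + M) * u / 2 * (a1 - a2) + u * (r - r') * b2
    linear_combination (1 - u) * b3 - (1 + G) * e

end TorusSeries


/-! ### From one-sided Sobolev sequences to two-sided series. -/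

theorem HasSum.int_to_pnat {G : Type*} [AddCommGroup G] [TopologicalSpace G]
    [IsTopologicalAddGroup G] {f : ℤ → G} {a : G} (hf : HasSum f a) :
    HasSum (fun n : ℕ+ => f (n : ℕ) + f (-(n : ℕ))) (a - f 0) := by
  have h1 := (hasSum_nat_add_iff' 1).2 hf.nat_add_neg
  have h2 := (Equiv.pnatEquivNat.hasSum_iff
    (f := fun n : ℕ => f ((n + 1 : ℕ) : ℤ) + f (-((n + 1 : ℕ) : ℤ)))).2 h1
  convert h2 using 1
  · funext n
    have : n.natPred + 1 = (n : ℕ) := n.natPred_add_one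
    change _ = f ((n.natPred + 1 : ℕ) : ℤ) + f (-((n.natPred + 1 : ℕ) : ℤ))
    rw [this]
  · simp

theorem hasSum_int_of_pnat {G : Type*} [AddCommGroup G] [TopologicalSpace G]
    [IsTopologicalAddGroup G] {f : ℤ → G} {a b : G} (h0 : f 0 = 0)
    (ha : HasSum (fun n : ℕ+ => f (n : ℕ)) a) (hb : HasSum (fun n : ℕ+ => f (-(n : ℕ))) b) :
    HasSum f (a + b) := by
  have key : ∀ (g : ℕ → G) (c : G), g 0 = 0 → HasSum (fun n : ℕ+ => g n) c → HasSum g c := by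
    intro g c hg hc
    refine (PNat.coe_injective.hasSum_iff fun n hn => ?_).1 hc
    rcases Nat.eq_zero_or_pos n with rfl | hpos
    · exact hg
    · exact absurd ⟨⟨n, hpos⟩, rfl⟩ hn
  have h := (key (fun n => f n) a (by simpa using h0) ha).of_nat_of_neg
    (key (fun n => f (-(n : ℤ))) b (by simpa using h0) hb)
  rwa [h0, sub_zero] at h

/-- `|n|` as a positive integer, for `n ≠ 0`. -/
def absPNat (n : ℤ) : ℕ+ := n.natAbs.toPNat'

theorem absPNat_natCast (n : ℕ+) : absPNat ((n : ℕ) : ℤ) = n := by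
  simp [absPNat]

theorem absPNat_neg (n : ℤ) : absPNat (-n) = absPNat n := by
  simp [absPNat]

theorem japaneseBracket_rpow (s : ℝ) (n : ℕ+) : japaneseBracket n ^ s = wt s ((n : ℕ) : ℤ) := by
  simp [japaneseBracket, wt]

theorem wt_neg (s : ℝ) (n : ℤ) : wt s (-n) = wt s n := by
  simp [wt]

theorem wt_absPNat (s : ℝ) {n : ℤ} (hn : n ≠ 0) :
    japaneseBracket (absPNat n) ^ s = wt s n := by
  obtain ⟨k, rfl | rfl⟩ := n.eq_nat_or_neg
  · lift k to ℕ+ using by omega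
    rw [absPNat_natCast, japaneseBracket_rpow]
  · lift k to ℕ+ using by omega
    rw [absPNat_neg, absPNat_natCast, japaneseBracket_rpow, wt_neg]

theorem wt_mul_wt_le {t τ s : ℝ} (h : t + τ ≤ s) (n : ℤ) : wt t n * wt τ n ≤ wt s n := by
  rw [wt, wt, ← rpow_add (lt_of_lt_of_le one_pos (le_max_left _ _))]
  exact rpow_le_rpow_of_exponent_le (le_max_left _ _) h

/-- The space `sobolevCoeff s`, with the topology of its norm. -/
def SobolevSeq (s : ℝ) : Type := sobolevCoeff s

instance (s : ℝ) : NormedAddCommGroup (SobolevSeq s) :=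
  inferInstanceAs (NormedAddCommGroup (sobolevCoeff s))

instance (s : ℝ) : NormedSpace ℝ (SobolevSeq s) :=
  inferInstanceAs (NormedSpace ℝ (sobolevCoeff s))

/-- The terms of the sequence. -/
def SobolevSeq.coeff {s : ℝ} (a : SobolevSeq s) : ℕ+ → ℝ :=
  Subtype.val (p := fun a => a ∈ sobolevCoeff s) a

theorem hasSum_sobolev (s : ℝ) (a : SobolevSeq s) :
    HasSum (fun n => (japaneseBracket n ^ s * a.coeff n) ^ 2) (‖a‖ ^ 2) := by
  have h := ((mem_sobolevCoeff_iff s a.coeff).1 a.2).hasSum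
  have e : ‖a‖ ^ 2 = ∑' n, japaneseBracket n ^ (2 * s) * |a.coeff n| ^ 2 :=
    sobolevCoeff_norm_sq s a
  rw [← e] at h
  simp only [← sobolev_weight_sq] at h
  exact h

/-- The sequence `(⟨n⟩ᵗ a_{|n|} eₙ)`, for `n ≠ 0`. -/
def embedCoeff (t : ℝ) (e : ℤ → Wiener) (a : ℕ+ → ℝ) (n : ℤ) : Wiener :=
  if n = 0 then 0 else (wt t n * a (absPNat n)) • e n

section embed

variable {t τ s C : ℝ} {e : ℤ → Wiener}

/-- A symbol of size `⟨n⟩^τ` costs `τ` derivatives, whence `t + τ ≤ s`. The norm of `a` is counted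
twice, for `n` and for `-n`. -/
theorem exists_embed_bound (hC : 0 ≤ C) (he : ∀ n, ‖e n‖ ≤ C * wt τ n) (h : t + τ ≤ s)
    (a : SobolevSeq s) : ∃ g : ℤ → ℝ, HasSum g (C ^ 2 * (‖a‖ ^ 2 + ‖a‖ ^ 2)) ∧
      ∀ n, ‖embedCoeff t e a.coeff n‖ ^ 2 ≤ g n := by
  set f : ℤ → ℝ := fun n => if n = 0 then 0 else
    (japaneseBracket (absPNat n) ^ s * a.coeff (absPNat n)) ^ 2 with hf
  have hf0 : f 0 = 0 := by simp [hf]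
  have h1 : ∀ n : ℕ+, f (n : ℕ) = (japaneseBracket n ^ s * a.coeff n) ^ 2 := fun n => by
    simp [hf, absPNat_natCast]
  have h2 : ∀ n : ℕ+, f (-(n : ℕ)) = (japaneseBracket n ^ s * a.coeff n) ^ 2 := fun n => by
    simp [hf, absPNat_natCast, absPNat_neg]
  have hs : HasSum f (‖a‖ ^ 2 + ‖a‖ ^ 2) := by
    refine hasSum_int_of_pnat hf0 ?_ ?_
    · simpa only [h1] using hasSum_sobolev s a
    · simpa only [h2] using hasSum_sobolev s a
  refine ⟨fun n => C ^ 2 * f n, hs.mul_left _, fun n => ?_⟩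
  by_cases hn : n = 0
  · simp [embedCoeff, hn, hf]
  · simp only [embedCoeff, hf, if_neg hn]
    rw [wt_absPNat s hn, ← mul_pow, norm_smul, norm_mul, norm_of_nonneg (wt_pos t n).le, ← sq_abs (C * _),
      abs_mul, abs_mul, abs_of_nonneg hC, abs_of_pos (wt_pos s n), ← Real.norm_eq_abs (a.coeff _)]
    refine pow_le_pow_left₀ (by have := (wt_pos t n).le; positivity) ?_ 2
    calc wt t n * ‖a.coeff (absPNat n)‖ * ‖e n‖ ≤ wt t n * ‖a.coeff (absPNat n)‖ * (C * wt τ n) :=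
          mul_le_mul_of_nonneg_left (he n) (mul_nonneg (wt_pos t n).le (norm_nonneg _))
      _ = C * ((wt t n * wt τ n) * ‖a.coeff (absPNat n)‖) := by ring
      _ ≤ C * (wt s n * ‖a.coeff (absPNat n)‖) := by
          refine mul_le_mul_of_nonneg_left ?_ hC
          exact mul_le_mul_of_nonneg_right (wt_mul_wt_le h n) (norm_nonneg _)

/-- The operator taking `(aₙ)` to the function with Fourier coefficients `a_{|n|} eₙ`. -/
def embed (t : ℝ) (e : ℤ → Wiener) (hC : 0 ≤ C) (he : ∀ n, ‖e n‖ ≤ C * wt τ n) (h : t + τ ≤ s) :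
    SobolevSeq s →L[ℝ] TorusSeries :=
  LinearMap.mkContinuous
    ({
      toFun := fun a : SobolevSeq s => (⟨embedCoeff t e a.coeff, memℓp_gen (by
        obtain ⟨g, hg, hle⟩ := exists_embed_bound hC he h a
        simpa using Summable.of_nonneg_of_le (fun n => sq_nonneg _) hle hg.summable)⟩ : TorusSeries)
      map_add' := fun a b => by
        ext1; funext n
        change embedCoeff t e (a.coeff + b.coeff) n = embedCoeff t e a.coeff n + embedCoeff t e b.coeff n
        unfold embedCoeff
        split_ifs
        · simp
        · rw [Pi.add_apply, mul_add, add_smul]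
      map_smul' := fun (c : ℝ) a => by
        ext1; funext n
        change embedCoeff t e (c • a.coeff) n = c • embedCoeff t e a.coeff n
        unfold embedCoeff
        split_ifs
        · simp
        · rw [Pi.smul_apply, smul_smul, smul_eq_mul, mul_left_comm] } :
      SobolevSeq s →ₗ[ℝ] TorusSeries)
    (C * 2) (fun a => by
      obtain ⟨g, hg, hle⟩ := exists_embed_bound hC he h a
      refine TorusSeries.norm_le_of_hasSum (by positivity) hg.summable hle ?_
      rw [hg.tsum_eq]
      nlinarith [sq_nonneg (C * ‖a‖)])

/-- The weight in the embedding cancels the one in `waveCoeff`; the terms `n` and `-n` are grouped.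
-/
theorem hasSum_evalWith_embed (hC : 0 ≤ C) (he : ∀ n, ‖e n‖ ≤ C * wt τ n) (h : t + τ ≤ s)
    (ht : 1 < t) (m : ℕ) (x : ℝ) (φ : Wiener →L[ℝ] ℂ) (a : SobolevSeq s) :
    HasSum (fun n : ℕ+ => (a.coeff n : ℂ) *
      (Complex.exp (n * m * x * Complex.I) * φ (e (n : ℕ))
        + Complex.exp (-(n * m * x * Complex.I)) * φ (e (-(n : ℕ)))))
      (TorusSeries.evalWith m t x φ (embed t e hC he h a)) := by
  have h1 := (TorusSeries.hasSum_evalWith ht m x φ (embed t e hC he h a)).int_to_pnat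
  have h2 : ∀ n, embed t e hC he h a n = embedCoeff t e a.coeff n := fun _ => rfl
  simp only [h2] at h1
  have h3 : embedCoeff t e a.coeff 0 = 0 := by simp [embedCoeff]
  rw [h3, map_zero, mul_zero, sub_zero] at h1
  refine h1.congr_fun fun n => ?_
  have hw : ((wt t ((n : ℕ) : ℤ) : ℝ) : ℂ) ≠ 0 := Complex.ofReal_ne_zero.2 (wt_pos _ _).ne'
  simp only [embedCoeff, absPNat_neg, absPNat_natCast, wt_neg, TorusSeries.waveCoeff]
  rw [if_neg (by simp), if_neg (by simp), map_smul, map_smul, Complex.real_smul,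
    Complex.real_smul]
  push_cast
  have e1 : -((n : ℕ) : ℂ) * m * x * Complex.I = -((n : ℕ) * m * x * Complex.I) := by ring
  rw [e1]
  field_simp

end embed

/-! ### Restriction to `θ = 0` and parity. -/

namespace TorusSeries

variable {t : ℝ}

/-- The sum of the coefficients. -/
def _root_.Wiener.total : Wiener →L[ℝ] ℝ := Wiener.lift (fun _ => 1) fun _ => by simp

theorem _root_.Wiener.eval_zero (a : Wiener) : Wiener.eval 0 a = (Wiener.total a : ℂ) := by
  have h1 := (Wiener.hasSum_lift (fun _ => (1 : ℝ)) (fun _ => by simp) a).mapL Complex.ofRealCLM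
  refine HasSum.unique ?_ h1
  refine (Wiener.hasSum_lift _ _ a).congr_fun fun k => ?_
  simp

theorem abs_total_le (v : TorusSeries) (n : ℤ) : |Wiener.total (v n)| ≤ ‖v n‖ :=
  Wiener.norm_lift_apply_le (fun _ => (1 : ℝ)) (fun _ => by simp) (v n)

/-- The coefficients `αₙ + c α₋ₙ`, where `αₙ` are the Fourier coefficients on `θ = 0`. -/
def foldCoeff (t c : ℝ) (v : ℤ → Wiener) (n : ℕ+) : ℝ :=
  (wt t ((n : ℕ) : ℤ))⁻¹ * (Wiener.total (v (n : ℕ)) + c * Wiener.total (v (-(n : ℕ))))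

theorem weighted_foldCoeff (t c : ℝ) (v : ℤ → Wiener) (n : ℕ+) :
    japaneseBracket n ^ t * foldCoeff t c v n
      = Wiener.total (v (n : ℕ)) + c * Wiener.total (v (-(n : ℕ))) := by
  rw [japaneseBracket_rpow, foldCoeff, mul_inv_cancel_left₀ (wt_pos _ _).ne']

theorem foldCoeff_bound {c : ℝ} (hc : |c| ≤ 1) (t : ℝ) (v : TorusSeries) :
    (Summable fun n => (japaneseBracket n ^ t * foldCoeff t c v n) ^ 2) ∧
      ∑' n, (japaneseBracket n ^ t * foldCoeff t c v n) ^ 2 ≤ 2 * ‖v‖ ^ 2 := by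
  have h1 := ((v.hasSum_norm_sq.int_to_pnat).mul_left 2)
  have h2 : ∀ n : ℕ+, (japaneseBracket n ^ t * foldCoeff t c v n) ^ 2
      ≤ 2 * (‖v (n : ℕ)‖ ^ 2 + ‖v (-(n : ℕ))‖ ^ 2) := by
    intro n
    rw [weighted_foldCoeff]
    have a1 := abs_total_le v ((n : ℕ) : ℤ)
    have a2 := abs_total_le v (-((n : ℕ) : ℤ))
    have a3 : |c * Wiener.total (v (-(n : ℕ)))| ≤ ‖v (-(n : ℕ))‖ := by
      rw [abs_mul]
      exact (mul_le_of_le_one_left (abs_nonneg _) hc).trans a2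
    have b1 := sq_le_sq' (neg_le_of_abs_le a1) (le_of_abs_le a1)
    have b3 := sq_le_sq' (neg_le_of_abs_le a3) (le_of_abs_le a3)
    nlinarith [add_sq_le (a := Wiener.total (v (n : ℕ))) (b := c * Wiener.total (v (-(n : ℕ))))]
  have h3 := Summable.of_nonneg_of_le (fun n => sq_nonneg _) h2 h1.summable
  refine ⟨h3, (h3.tsum_le_tsum h2 h1.summable).trans ?_⟩
  rw [h1.tsum_eq]
  nlinarith [sq_nonneg ‖v 0‖]

/-- The operator restricting to `θ = 0` and extracting the coefficients `αₙ + c α₋ₙ`. -/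
def fold (t : ℝ) {c : ℝ} (hc : |c| ≤ 1) : TorusSeries →L[ℝ] SobolevSeq t :=
  LinearMap.mkContinuous
    ({
      toFun := fun v : TorusSeries => (⟨foldCoeff t c v, (mem_sobolevCoeff_iff t _).2 (by
        simpa only [sobolev_weight_sq] using (foldCoeff_bound hc t v).1)⟩ : sobolevCoeff t)
      map_add' := fun v w => by
        apply Subtype.ext; funext n
        change foldCoeff t c (v + w : TorusSeries) n = foldCoeff t c v n + foldCoeff t c w n
        simp only [foldCoeff, lp.coeFn_add, Pi.add_apply, map_add]
        ring
      map_smul' := fun (r : ℝ) v => by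
        apply Subtype.ext; funext n
        change foldCoeff t c (r • v : TorusSeries) n = r * foldCoeff t c v n
        simp only [foldCoeff, lp.coeFn_smul, Pi.smul_apply, map_smul, smul_eq_mul]
        ring } : TorusSeries →ₗ[ℝ] SobolevSeq t)
    2 (fun v => by
      refine le_of_sq_le_sq ?_ (by positivity)
      have := (foldCoeff_bound hc t v).2
      simp only [sobolev_weight_sq] at this
      refine (sobolevCoeff_norm_sq t _).le.trans ?_
      refine this.trans ?_
      nlinarith [sq_nonneg ‖v‖])

theorem fold_apply (t : ℝ) {c : ℝ} (hc : |c| ≤ 1) (v : TorusSeries) (n : ℕ+) :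
    (fold t hc v).coeff n = foldCoeff t c v n := rfl

theorem hasSum_ev_zero (ht : 1 < t) (m : ℕ) (x : ℝ) (v : TorusSeries) :
    HasSum (fun n : ℕ+ => waveCoeff m t x (n : ℕ) * (Wiener.total (v (n : ℕ)) : ℂ)
      + waveCoeff m t x (-(n : ℕ)) * (Wiener.total (v (-(n : ℕ))) : ℂ))
      (ev m t x 0 v - Wiener.total (v 0)) := by
  have h := (hasSum_evalWith ht m x (Wiener.eval 0) v).int_to_pnat
  simp only [Wiener.eval_zero] at h
  have h0 : waveCoeff m t x 0 = 1 := by simp [waveCoeff, wt_zero_right]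
  rw [h0, one_mul] at h
  exact h

theorem waveCoeff_eq (m : ℕ) (t x : ℝ) (n : ℕ+) :
    waveCoeff m t x (n : ℕ) = ⟨(wt t ((n : ℕ) : ℤ))⁻¹ * cos (n * m * x),
      (wt t ((n : ℕ) : ℤ))⁻¹ * sin (n * m * x)⟩ ∧
    waveCoeff m t x (-(n : ℕ)) = ⟨(wt t ((n : ℕ) : ℤ))⁻¹ * cos (n * m * x),
      -((wt t ((n : ℕ) : ℤ))⁻¹ * sin (n * m * x))⟩ := by
  have e1 := Complex.exp_ofReal_mul_I_re (n * m * x)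
  have e2 := Complex.exp_ofReal_mul_I_im (n * m * x)
  have e3 := Complex.exp_ofReal_mul_I_re (-(n * m * x))
  have e4 := Complex.exp_ofReal_mul_I_im (-(n * m * x))
  push_cast at e1 e2 e3 e4
  constructor
  · apply Complex.ext
    · simp [waveCoeff, e1]
    · simp [waveCoeff, e2]
  · have e5 : ((-(n : ℕ) : ℤ) : ℂ) * m * x * Complex.I = -((n : ℕ) * m * x) * Complex.I := by
      push_cast; ring
    rw [waveCoeff, e5, wt_neg]
    apply Complex.ext
    · simp only [Complex.re_ofReal_mul]; rw [e3, cos_neg]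
    · simp only [Complex.im_ofReal_mul]; rw [e4, sin_neg]; ring

/-- For real `αₙ` the imaginary part of `αₙ exp (inmx) + α₋ₙ exp (-inmx)` is `(αₙ - α₋ₙ) sin (nmx)`,
and the zeroth term is real. This is why `F₁` is odd with mean zero. -/
theorem hasSum_fold_sin (ht : 1 < t) (m : ℕ) (x : ℝ) (hc : |(-1 : ℝ)| ≤ 1) (v : TorusSeries) :
    HasSum (fun n : ℕ+ => (fold t hc v).coeff n * sin (n * m * x)) (ev m t x 0 v).im := by
  have h := (hasSum_ev_zero ht m x v).mapL Complex.imCLM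
  simp only [Complex.imCLM_apply, Complex.sub_im, Complex.ofReal_im, sub_zero] at h
  refine h.congr_fun fun n => ?_
  rw [fold_apply, foldCoeff, (waveCoeff_eq m t x n).1, (waveCoeff_eq m t x n).2]
  simp
  ring

/-- The real parts combine to `(αₙ + α₋ₙ) cos (nmx)`, while the constant `α₀` is removed: this is
the passage to functions modulo constants. -/
theorem hasSum_fold_cos (ht : 1 < t) (m : ℕ) (x : ℝ) (hc : |(1 : ℝ)| ≤ 1) (v : TorusSeries) :
    HasSum (fun n : ℕ+ => (fold t hc v).coeff n * cos (n * m * x))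
      ((ev m t x 0 v).re - Wiener.total (v 0)) := by
  have h := (hasSum_ev_zero ht m x v).mapL Complex.reCLM
  simp only [Complex.reCLM_apply, Complex.sub_re, Complex.ofReal_re] at h
  refine h.congr_fun fun n => ?_
  rw [fold_apply, foldCoeff, (waveCoeff_eq m t x n).1, (waveCoeff_eq m t x n).2]
  simp
  ring

end TorusSeries


/-! ### Termwise differentiation of cosine and sine series. -/

/-- `∑ cₙ cos (n m x)`. -/
def cosSeries (m : ℕ) (c : ℕ+ → ℝ) (x : ℝ) : ℝ := ∑' n : ℕ+, c n * cos ((n : ℝ) * (m : ℝ) * x)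

/-- `∑ cₙ sin (n m x)`. -/
def sinSeries (m : ℕ) (c : ℕ+ → ℝ) (x : ℝ) : ℝ := ∑' n : ℕ+, c n * sin ((n : ℝ) * (m : ℝ) * x)

section series

variable {m : ℕ} {c : ℕ+ → ℝ}

theorem summable_mul_cos (hc : Summable fun n => |c n|) (x : ℝ) :
    Summable fun n : ℕ+ => c n * cos ((n : ℝ) * (m : ℝ) * x) := by
  refine Summable.of_norm_bounded hc fun n => ?_
  rw [norm_mul, norm_eq_abs, norm_eq_abs]
  exact mul_le_of_le_one_right (abs_nonneg _) (abs_cos_le_one _)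

theorem summable_mul_sin (hc : Summable fun n => |c n|) (x : ℝ) :
    Summable fun n : ℕ+ => c n * sin ((n : ℝ) * (m : ℝ) * x) := by
  refine Summable.of_norm_bounded hc fun n => ?_
  rw [norm_mul, norm_eq_abs, norm_eq_abs]
  exact mul_le_of_le_one_right (abs_nonneg _) (abs_sin_le_one _)

theorem continuous_cosSeries (hc : Summable fun n => |c n|) : Continuous (cosSeries m c) := by
  refine continuous_tsum (fun n => by fun_prop) hc fun n x => ?_
  rw [norm_mul, norm_eq_abs, norm_eq_abs]
  exact mul_le_of_le_one_right (abs_nonneg _) (abs_cos_le_one _)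

/-- Multiplication of the coefficients by the frequency. -/
def freqMul (m : ℕ) (c : ℕ+ → ℝ) (n : ℕ+) : ℝ := c n * ((n : ℝ) * (m : ℝ))

theorem hasDerivAt_cosSeries (hc : Summable fun n => |c n|)
    (hc' : Summable fun n => |freqMul m c n|) (x : ℝ) :
    HasDerivAt (cosSeries m c) (-sinSeries m (freqMul m c) x) x := by
  rw [sinSeries, ← tsum_neg]
  refine hasDerivAt_tsum (g := fun n y => c n * cos ((n : ℝ) * (m : ℝ) * y))
    (g' := fun n y => -(freqMul m c n * sin ((n : ℝ) * (m : ℝ) * y))) hc' (fun n y => ?_) (fun n y => ?_) (summable_mul_cos hc 0) x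
  · have := (((hasDerivAt_id y).const_mul ((n : ℝ) * (m : ℝ))).cos).const_mul (c n)
    refine this.congr_deriv ?_
    simp only [freqMul, id]
    ring
  · rw [norm_neg, norm_mul, norm_eq_abs, norm_eq_abs]
    exact mul_le_of_le_one_right (abs_nonneg _) (abs_sin_le_one _)

theorem hasDerivAt_sinSeries (hc : Summable fun n => |c n|)
    (hc' : Summable fun n => |freqMul m c n|) (x : ℝ) :
    HasDerivAt (sinSeries m c) (cosSeries m (freqMul m c) x) x := by
  rw [cosSeries]
  refine hasDerivAt_tsum (g := fun n y => c n * sin ((n : ℝ) * (m : ℝ) * y))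
    (g' := fun n y => freqMul m c n * cos ((n : ℝ) * (m : ℝ) * y)) hc' (fun n y => ?_) (fun n y => ?_) (summable_mul_sin hc 0) x
  · have := (((hasDerivAt_id y).const_mul ((n : ℝ) * (m : ℝ))).sin).const_mul (c n)
    refine this.congr_deriv ?_
    simp only [freqMul, id]
    ring
  · rw [norm_mul, norm_eq_abs, norm_eq_abs]
    exact mul_le_of_le_one_right (abs_nonneg _) (abs_cos_le_one _)

theorem deriv_cosSeries (hc : Summable fun n => |c n|)
    (hc' : Summable fun n => |freqMul m c n|) :
    deriv (cosSeries m c) = fun x => -sinSeries m (freqMul m c) x :=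
  funext fun x => (hasDerivAt_cosSeries hc hc' x).deriv

theorem deriv_sinSeries (hc : Summable fun n => |c n|)
    (hc' : Summable fun n => |freqMul m c n|) :
    deriv (sinSeries m c) = cosSeries m (freqMul m c) :=
  funext fun x => (hasDerivAt_sinSeries hc hc' x).deriv

theorem contDiff_one_sinSeries (hc : Summable fun n => |c n|)
    (hc' : Summable fun n => |freqMul m c n|) : ContDiff ℝ 1 (sinSeries m c) := by
  rw [contDiff_one_iff_deriv]
  refine ⟨fun x => (hasDerivAt_sinSeries hc hc' x).differentiableAt, ?_⟩
  rw [deriv_sinSeries hc hc']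
  exact continuous_cosSeries hc'

theorem contDiff_two_cosSeries (hc : Summable fun n => |c n|)
    (hc' : Summable fun n => |freqMul m c n|)
    (hc'' : Summable fun n => |freqMul m (freqMul m c) n|) : ContDiff ℝ 2 (cosSeries m c) := by
  have h : (2 : WithTop ℕ∞) = 1 + 1 := by norm_num
  rw [h, contDiff_succ_iff_deriv]
  refine ⟨fun x => (hasDerivAt_cosSeries hc hc' x).differentiableAt, by simp, ?_⟩
  rw [deriv_cosSeries hc hc']
  exact (contDiff_one_sinSeries hc' hc'').neg

theorem deriv_deriv_cosSeries (hc : Summable fun n => |c n|)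
    (hc' : Summable fun n => |freqMul m c n|)
    (hc'' : Summable fun n => |freqMul m (freqMul m c) n|) :
    deriv (deriv (cosSeries m c)) = fun x => -cosSeries m (freqMul m (freqMul m c)) x := by
  rw [deriv_cosSeries hc hc']
  exact funext fun x => ((hasDerivAt_sinSeries hc' hc'' x).neg).deriv

end series

theorem abs_coeff_le {s : ℝ} (a : SobolevSeq s) (n : ℕ+) :
    |a.coeff n| ≤ ‖a‖ * (n : ℝ) ^ (-s) := by
  have h := (hasSum_sobolev s a).summable.le_tsum n fun _ _ => sq_nonneg _
  rw [(hasSum_sobolev s a).tsum_eq] at h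
  have h1 := abs_le_of_sq_le_sq h (norm_nonneg _)
  have hn : (1 : ℝ) ≤ n := by exact_mod_cast one_le (a := n)
  have hj : japaneseBracket n = n := max_eq_right hn
  have hp : 0 < (n : ℝ) ^ s := rpow_pos_of_pos (by linarith) s
  rw [hj, abs_mul, abs_of_pos hp] at h1
  rw [rpow_neg (by linarith), ← div_eq_mul_inv, le_div_iff₀ hp]
  linarith

/-- Coefficients are `O(n⁻ˢ)` with `s ≥ 4`; after at most two derivatives they are still `O(n⁻²)`.
-/
theorem summable_freq {s : ℝ} (hs : 4 ≤ s) (m : ℕ) (a : SobolevSeq s) :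
    (Summable fun n => |a.coeff n|) ∧ (Summable fun n => |freqMul m a.coeff n|) ∧
      (Summable fun n => |freqMul m (freqMul m a.coeff) n|) := by
  have key : ∀ k : ℕ, k ≤ 2 → Summable fun n : ℕ+ => |a.coeff n| * ((n : ℝ) * (m : ℝ)) ^ k := by
    intro k hk
    have h1 : Summable fun n : ℕ+ => ((n : ℕ) : ℝ) ^ (-(2 : ℝ)) :=
      (Real.summable_nat_rpow.2 (by norm_num)).comp_injective PNat.coe_injective
    refine Summable.of_nonneg_of_le (fun n => by positivity) (fun n => ?_)
      (h1.mul_left (‖a‖ * (m : ℝ) ^ k))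
    have hn : (1 : ℝ) ≤ n := by exact_mod_cast one_le (a := n)
    calc |a.coeff n| * ((n : ℝ) * (m : ℝ)) ^ k
        ≤ (‖a‖ * (n : ℝ) ^ (-s)) * ((n : ℝ) * (m : ℝ)) ^ k :=
          mul_le_mul_of_nonneg_right (abs_coeff_le a n) (by positivity)
      _ = ‖a‖ * (m : ℝ) ^ k * ((n : ℝ) ^ (-s) * (n : ℝ) ^ k) := by rw [mul_pow]; ring
      _ = ‖a‖ * (m : ℝ) ^ k * (n : ℝ) ^ (-s + k) := by
          rw [rpow_add (by linarith), rpow_natCast]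
      _ ≤ ‖a‖ * (m : ℝ) ^ k * (n : ℝ) ^ (-(2 : ℝ)) := by
          refine mul_le_mul_of_nonneg_left (rpow_le_rpow_of_exponent_le hn ?_) (by positivity)
          have : (k : ℝ) ≤ 2 := by exact_mod_cast hk
          linarith
  have hnm : ∀ n : ℕ+, |(n : ℝ) * (m : ℝ)| = (n : ℝ) * (m : ℝ) := fun n =>
    abs_of_nonneg (by positivity)
  refine ⟨?_, ?_, ?_⟩
  · simpa using key 0 (by norm_num)
  · simpa [freqMul, abs_mul] using key 1 (by norm_num)
  · refine (key 2 le_rfl).congr fun n => ?_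
    rw [freqMul, freqMul, abs_mul, abs_mul, hnm]
    ring

/-! ### Symbols of translation, difference quotient and derivatives. -/

/-- The element `u (1 - uᴺ) / (1 - u)` of the Wiener algebra. -/
def geomDiff (N : ℤ) : Wiener :=
  if 0 ≤ N then ∑ j ∈ Finset.range N.natAbs, Wiener.mono (j + 1)
  else -∑ j ∈ Finset.range N.natAbs, Wiener.mono (j + 1 + N)

theorem norm_geomDiff_le (N : ℤ) : ‖geomDiff N‖ ≤ |(N : ℝ)| := by
  have h : (N.natAbs : ℝ) = |(N : ℝ)| := by rw [Nat.cast_natAbs]; push_cast; rfl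
  unfold geomDiff
  split_ifs
  · refine (norm_sum_le _ _).trans ?_
    simp [Wiener.norm_mono, h]
  · rw [norm_neg]
    refine (norm_sum_le _ _).trans ?_
    simp [Wiener.norm_mono, h]

/-- A geometric sum. For `N < 0` the quotient is minus the sum of `u^(N+1), …, u^0`. -/
theorem one_sub_mul_eval_geomDiff (N : ℤ) (θ : ℝ) :
    (1 - Complex.exp (θ * Complex.I)) * Wiener.eval θ (geomDiff N)
      = Complex.exp (θ * Complex.I) * (1 - Complex.exp (N * θ * Complex.I)) := by
  have hz : ∀ k : ℤ, Wiener.eval θ (Wiener.mono k) = Complex.exp (θ * Complex.I) ^ k := fun k => by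
    rw [Wiener.eval_mono, ← Complex.exp_int_mul]; ring_nf
  have hN : Complex.exp (N * θ * Complex.I) = Complex.exp (θ * Complex.I) ^ N := by
    rw [← hz, Wiener.eval_mono]
  rw [hN]
  set u := Complex.exp (θ * Complex.I) with hu
  have hu0 : u ≠ 0 := Complex.exp_ne_zero _
  unfold geomDiff
  split_ifs with h
  · obtain ⟨k, rfl⟩ := Int.eq_ofNat_of_zero_le h
    simp only [map_sum, hz, Int.natAbs_natCast, zpow_add₀ hu0, zpow_one, ← Finset.sum_mul,
      zpow_natCast]
    linear_combination u * (mul_neg_geom_sum u k)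
  · obtain ⟨k, hk⟩ := Int.eq_ofNat_of_zero_le (by omega : 0 ≤ -N)
    obtain rfl : N = -(k : ℤ) := by omega
    simp only [map_neg, map_sum, hz, Int.natAbs_neg, Int.natAbs_natCast, zpow_add₀ hu0, zpow_one,
      ← Finset.sum_mul, zpow_natCast, zpow_neg]
    have := mul_neg_geom_sum u k
    have h2 : u ^ k * (u ^ k)⁻¹ = 1 := mul_inv_cancel₀ (pow_ne_zero _ hu0)
    linear_combination (-u * (u ^ k)⁻¹) * this + u * h2

section symbols

open TorusSeries

variable {t s : ℝ} (m : ℕ)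

theorem wt_one_eq (n : ℤ) : |(n : ℝ)| ≤ wt 1 n := by
  rw [wt, rpow_one]; exact le_max_right _ _

theorem wt_two_eq (n : ℤ) : (n : ℝ) ^ 2 ≤ wt 2 n := by
  have h : wt 2 n = (max 1 |(n : ℝ)|) ^ 2 := by
    rw [wt]; exact rpow_two _
  rw [h, ← sq_abs]
  exact pow_le_pow_left₀ (abs_nonneg _) (le_max_right _ _) 2

/-- `∑ aₙ cos (n m x)` as a function of `(x, θ)`. -/
def cosAt (h : t + 0 ≤ s) : SobolevSeq s →L[ℝ] TorusSeries :=
  embed (C := 1 / 2) (τ := 0) t (fun _ => (1 / 2 : ℝ) • Wiener.mono 0) (by norm_num)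
    (fun n => by simp [norm_smul, Wiener.norm_mono, wt]) h

/-- `∑ aₙ cos (n m (x + θ))` as a function of `(x, θ)`. -/
def cosShift (h : t + 0 ≤ s) : SobolevSeq s →L[ℝ] TorusSeries :=
  embed (C := 1 / 2) (τ := 0) t (fun n => (1 / 2 : ℝ) • Wiener.mono (n * m)) (by norm_num)
    (fun n => by simp [norm_smul, Wiener.norm_mono, wt]) h

/-- `u (f(x) - f(x + θ)) / (1 - u)` for `f = ∑ aₙ cos (n m x)`. -/
def cosQuot (h : t + 1 ≤ s) : SobolevSeq s →L[ℝ] TorusSeries :=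
  embed (C := 1 / 2 * m) (τ := 1) t (fun n => (1 / 2 : ℝ) • geomDiff (n * m)) (by positivity)
    (fun n => by
      rw [norm_smul, norm_of_nonneg (by norm_num), mul_assoc]
      refine mul_le_mul_of_nonneg_left ((norm_geomDiff_le _).trans ?_) (by norm_num)
      push_cast
      rw [abs_mul, Nat.abs_cast, mul_comm]
      exact mul_le_mul_of_nonneg_left (wt_one_eq n) (Nat.cast_nonneg m)) h

/-- `i` times the derivative of `∑ aₙ cos (n m x)`. -/
def cosDeriv (h : t + 1 ≤ s) : SobolevSeq s →L[ℝ] TorusSeries :=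
  embed (C := 1 / 2 * m) (τ := 1) t (fun n => (-(1 / 2) * (n * m) : ℝ) • Wiener.mono 0)
    (by positivity) (fun n => by
      rw [norm_smul, Wiener.norm_mono, mul_one, norm_eq_abs, abs_mul, abs_mul, Nat.abs_cast,
        abs_neg, abs_of_nonneg (by norm_num), mul_assoc, mul_comm |(n : ℝ)|]
      exact mul_le_mul_of_nonneg_left (mul_le_mul_of_nonneg_left (wt_one_eq n)
        (Nat.cast_nonneg m)) (by norm_num)) h

/-- The second derivative of `∑ aₙ cos (n m x)`. -/
def cosDeriv₂ (h : t + 2 ≤ s) : SobolevSeq s →L[ℝ] TorusSeries :=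
  embed (C := 1 / 2 * (m : ℝ) ^ 2) (τ := 2) t
    (fun n => (-(1 / 2) * (n * m) ^ 2 : ℝ) • Wiener.mono 0)
    (by positivity) (fun n => by
      rw [norm_smul, Wiener.norm_mono, mul_one, norm_eq_abs, abs_mul, abs_neg,
        abs_of_nonneg (by norm_num : (0 : ℝ) ≤ 1 / 2), abs_of_nonneg (sq_nonneg _), mul_assoc, mul_pow, mul_comm ((n : ℝ) ^ 2)]
      exact mul_le_mul_of_nonneg_left (mul_le_mul_of_nonneg_left (wt_two_eq n)
        (sq_nonneg _)) (by norm_num)) h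

/-- The derivative of `∑ aₙ sin (n m x)`. -/
def sinDeriv (h : t + 1 ≤ s) : SobolevSeq s →L[ℝ] TorusSeries :=
  embed (C := 1 / 2 * m) (τ := 1) t (fun n => (1 / 2 * (|(n : ℝ)| * m) : ℝ) • Wiener.mono 0)
    (by positivity) (fun n => by
      rw [norm_smul, Wiener.norm_mono, mul_one, norm_eq_abs, abs_of_nonneg (by positivity),
        mul_assoc, mul_comm |(n : ℝ)|]
      exact mul_le_mul_of_nonneg_left (mul_le_mul_of_nonneg_left (wt_one_eq n)
        (Nat.cast_nonneg m)) (by norm_num)) h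

/-- The derivative of `∑ aₙ sin (n m x)` at `x + θ`. -/
def sinDerivShift (h : t + 1 ≤ s) : SobolevSeq s →L[ℝ] TorusSeries :=
  embed (C := 1 / 2 * m) (τ := 1) t
    (fun n => (1 / 2 * (|(n : ℝ)| * m) : ℝ) • Wiener.mono (n * m))
    (by positivity) (fun n => by
      rw [norm_smul, Wiener.norm_mono, mul_one, norm_eq_abs, abs_of_nonneg (by positivity),
        mul_assoc, mul_comm |(n : ℝ)|]
      exact mul_le_mul_of_nonneg_left (mul_le_mul_of_nonneg_left (wt_one_eq n)
        (Nat.cast_nonneg m)) (by norm_num)) h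

theorem exp_add_exp_neg (r : ℝ) :
    Complex.exp (r * Complex.I) + Complex.exp (-(r * Complex.I)) = ((2 * cos r : ℝ) : ℂ) := by
  push_cast
  rw [Complex.two_cos, neg_mul]

theorem exp_sub_exp_neg (r : ℝ) :
    Complex.exp (r * Complex.I) - Complex.exp (-(r * Complex.I))
      = ((2 * sin r : ℝ) : ℂ) * Complex.I := by
  have h := Complex.two_sin r
  rw [neg_mul] at h
  push_cast
  rw [h]
  linear_combination (-(Complex.exp (-(r * Complex.I)) - Complex.exp (r * Complex.I))) *
    Complex.I_sq

theorem evalWith_embed_cos {τ C : ℝ} {e : ℤ → Wiener} (hC : 0 ≤ C)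
    (he : ∀ n, ‖e n‖ ≤ C * wt τ n) (h : t + τ ≤ s) (ht : 1 < t) (x y : ℝ) (φ : Wiener →L[ℝ] ℂ)
    (a : SobolevSeq s) (κ : ℕ+ → ℝ)
    (h1 : ∀ n : ℕ+, φ (e (n : ℕ)) = (1 / 2 * κ n : ℝ) * Complex.exp (n * m * y * Complex.I))
    (h2 : ∀ n : ℕ+, φ (e (-(n : ℕ))) = (1 / 2 * κ n : ℝ) * Complex.exp (-(n * m * y * Complex.I)))
    (hs : Summable fun n => |a.coeff n * κ n|) :
    evalWith m t x φ (embed t e hC he h a)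
      = (cosSeries m (fun n => a.coeff n * κ n) (x + y) : ℝ) := by
  refine (hasSum_evalWith_embed hC he h ht m x φ a).unique ?_
  refine ((summable_mul_cos hs (x + y)).hasSum.mapL Complex.ofRealCLM).congr_fun fun n => ?_
  rw [h1, h2]
  have e1 := exp_add_exp_neg (n * m * (x + y))
  have e2 : ((n * m * (x + y) : ℝ) : ℂ) * Complex.I
      = n * m * x * Complex.I + n * m * y * Complex.I := by push_cast; ring
  rw [e2, neg_add, Complex.exp_add, Complex.exp_add] at e1
  simp only [Complex.ofRealCLM_apply]
  push_cast at e1 ⊢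
  linear_combination (a.coeff n * (1 / 2 * κ n) : ℂ) * e1

/-- Symbols odd in `n` turn cosine coefficients into `i` times a sine series, with real two-sided
coefficients. -/
theorem evalWith_embed_sin {τ C : ℝ} {e : ℤ → Wiener} (hC : 0 ≤ C)
    (he : ∀ n, ‖e n‖ ≤ C * wt τ n) (h : t + τ ≤ s) (ht : 1 < t) (x : ℝ) (φ : Wiener →L[ℝ] ℂ)
    (a : SobolevSeq s) (κ : ℕ+ → ℝ)
    (h1 : ∀ n : ℕ+, φ (e (n : ℕ)) = (1 / 2 * κ n : ℝ))
    (h2 : ∀ n : ℕ+, φ (e (-(n : ℕ))) = (-(1 / 2 * κ n) : ℝ))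
    (hs : Summable fun n => |a.coeff n * κ n|) :
    evalWith m t x φ (embed t e hC he h a)
      = (sinSeries m (fun n => a.coeff n * κ n) x : ℝ) * Complex.I := by
  refine (hasSum_evalWith_embed hC he h ht m x φ a).unique ?_
  refine (((summable_mul_sin hs x).hasSum.mapL Complex.ofRealCLM).mul_right
    Complex.I).congr_fun fun n => ?_
  rw [h1, h2]
  have e1 := exp_sub_exp_neg (n * m * x)
  have e2 : ((n * m * x : ℝ) : ℂ) * Complex.I = n * m * x * Complex.I := by push_cast; ring
  rw [e2] at e1
  simp only [Complex.ofRealCLM_apply]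
  push_cast at e1 ⊢
  linear_combination (a.coeff n * (1 / 2 * κ n) : ℂ) * e1

variable {m}

theorem ev_cosAt (hs : 4 ≤ s) (ht : 1 < t) (h : t + 0 ≤ s) (x θ : ℝ) (a : SobolevSeq s) :
    ev m t x θ (cosAt h a) = (cosSeries m a.coeff x : ℝ) := by
  have := evalWith_embed_cos m (e := fun _ => (1 / 2 : ℝ) • Wiener.mono 0) (C := 1 / 2) (τ := 0)
    (by norm_num) (fun n => by simp [norm_smul, Wiener.norm_mono, wt]) h ht x 0 (Wiener.eval θ) a
    (fun _ => 1) (fun n => by simp [Wiener.eval_mono]) (fun n => by simp [Wiener.eval_mono])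
    (by simpa using (summable_freq hs m a).1)
  simp only [mul_one, add_zero] at this
  exact this

theorem ev_cosShift (hs : 4 ≤ s) (ht : 1 < t) (h : t + 0 ≤ s) (x θ : ℝ) (a : SobolevSeq s) :
    ev m t x θ (cosShift m h a) = (cosSeries m a.coeff (x + θ) : ℝ) := by
  have := evalWith_embed_cos m (e := fun n => (1 / 2 : ℝ) • Wiener.mono (n * m)) (C := 1 / 2)
    (τ := 0) (by norm_num) (fun n => by simp [norm_smul, Wiener.norm_mono, wt]) h ht x θ
    (Wiener.eval θ) a (fun _ => 1) (fun n => by simp [Wiener.eval_mono])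
    (fun n => by simp [Wiener.eval_mono]) (by simpa using (summable_freq hs m a).1)
  simp only [mul_one] at this
  exact this

/-- On the mode `n m` the difference `η(x) - η(x + θ)` produces the factor `1 - u^(nm)`, divisible
by `1 - u`; the division costs a factor `|n| m`, that is, one derivative. -/
theorem ev_cosQuot (hs : 4 ≤ s) (ht : 1 < t) (h : t + 1 ≤ s) (x θ : ℝ) (a : SobolevSeq s) :
    (1 - Complex.exp (θ * Complex.I)) * ev m t x θ (cosQuot m h a)
      = Complex.exp (θ * Complex.I) *
        ((cosSeries m a.coeff x : ℝ) - (cosSeries m a.coeff (x + θ) : ℝ)) := by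
  have h0 : t + 0 ≤ s := by linarith
  have k1 := (hasSum_evalWith_embed _ _ h0 ht m x (Wiener.eval θ) a :
    HasSum _ (ev m t x θ (cosAt h0 a)))
  have k2 := (hasSum_evalWith_embed _ _ h0 ht m x (Wiener.eval θ) a :
    HasSum _ (ev m t x θ (cosShift m h0 a)))
  have k3 := (hasSum_evalWith_embed _ _ h ht m x (Wiener.eval θ) a :
    HasSum _ (ev m t x θ (cosQuot m h a)))
  rw [← ev_cosAt hs ht h0 x θ, ← ev_cosShift hs ht h0]
  refine (k3.mul_left (1 - Complex.exp (θ * Complex.I))).unique ?_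
  refine ((k1.sub k2).mul_left (Complex.exp (θ * Complex.I))).congr_fun fun n => ?_
  have g1 := one_sub_mul_eval_geomDiff ((n : ℕ) * m) θ
  have g2 := one_sub_mul_eval_geomDiff (-(n : ℕ) * m) θ
  simp only [map_smul, Wiener.eval_mono, Complex.real_smul]
  push_cast at g1 g2 ⊢
  rw [zero_mul, zero_mul, Complex.exp_zero]
  linear_combination (a.coeff n / 2 * Complex.exp (n * m * x * Complex.I) : ℂ) * g1
    + (a.coeff n / 2 * Complex.exp (-(n * m * x * Complex.I)) : ℂ) * g2

theorem ev_cosDeriv (hs : 4 ≤ s) (ht : 1 < t) (h : t + 1 ≤ s) (x θ : ℝ) (a : SobolevSeq s) :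
    ev m t x θ (cosDeriv m h a) = (deriv (cosSeries m a.coeff) x : ℝ) * Complex.I := by
  obtain ⟨s1, s2, -⟩ := summable_freq hs m a
  have := evalWith_embed_sin m (e := fun n => (-(1 / 2) * (n * m) : ℝ) • Wiener.mono 0) (τ := 1)
    (C := 1 / 2 * m) (by positivity) (fun n => by
      rw [norm_smul, Wiener.norm_mono, mul_one, norm_eq_abs, abs_mul, abs_mul, Nat.abs_cast,
        abs_neg, abs_of_nonneg (by norm_num), mul_assoc, mul_comm |(n : ℝ)|]
      exact mul_le_mul_of_nonneg_left (mul_le_mul_of_nonneg_left (wt_one_eq n)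
        (Nat.cast_nonneg m)) (by norm_num)) h ht x (Wiener.eval θ) a
    (fun n => -(n * m)) (fun n => by simp [Wiener.eval_mono]) (fun n => by simp [Wiener.eval_mono])
    (by simpa [freqMul] using s2)
  refine this.trans ?_
  rw [deriv_cosSeries s1 s2]
  simp [sinSeries, freqMul, tsum_neg]

theorem ev_cosDeriv₂ (hs : 4 ≤ s) (ht : 1 < t) (h : t + 2 ≤ s) (x θ : ℝ) (a : SobolevSeq s) :
    ev m t x θ (cosDeriv₂ m h a) = (deriv (deriv (cosSeries m a.coeff)) x : ℝ) := by
  obtain ⟨s1, s2, s3⟩ := summable_freq hs m a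
  have := evalWith_embed_cos m (e := fun n => (-(1 / 2) * (n * m) ^ 2 : ℝ) • Wiener.mono 0)
    (τ := 2) (C := 1 / 2 * (m : ℝ) ^ 2) (by positivity) (fun n => by
      rw [norm_smul, Wiener.norm_mono, mul_one, norm_eq_abs, abs_mul, abs_neg,
        abs_of_nonneg (by norm_num : (0 : ℝ) ≤ 1 / 2), abs_of_nonneg (sq_nonneg _), mul_assoc,
        mul_pow, mul_comm ((n : ℝ) ^ 2)]
      exact mul_le_mul_of_nonneg_left (mul_le_mul_of_nonneg_left (wt_two_eq n)
        (sq_nonneg _)) (by norm_num)) h ht x 0 (Wiener.eval θ) a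
    (fun n => -(n * m) ^ 2) (fun n => by simp [Wiener.eval_mono])
    (fun n => by simp [Wiener.eval_mono])
    (s3.congr fun n => by rw [freqMul, freqMul, ← abs_neg]; congr 1; ring)
  refine this.trans ?_
  rw [deriv_deriv_cosSeries s1 s2 s3]
  simp only [cosSeries, freqMul, ← tsum_neg, add_zero]
  congr 1
  refine tsum_congr fun n => ?_
  ring

theorem ev_sinDerivShift (hs : 4 ≤ s) (ht : 1 < t) (h : t + 1 ≤ s) (x θ : ℝ) (a : SobolevSeq s) :
    ev m t x θ (sinDerivShift m h a) = (deriv (sinSeries m a.coeff) (x + θ) : ℝ) := by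
  obtain ⟨s1, s2, -⟩ := summable_freq hs m a
  have := evalWith_embed_cos m
    (e := fun n => (1 / 2 * (|(n : ℝ)| * m) : ℝ) • Wiener.mono (n * m))
    (τ := 1) (C := 1 / 2 * m) (by positivity) (fun n => by
      rw [norm_smul, Wiener.norm_mono, mul_one, norm_eq_abs, abs_of_nonneg (by positivity),
        mul_assoc, mul_comm |(n : ℝ)|]
      exact mul_le_mul_of_nonneg_left (mul_le_mul_of_nonneg_left (wt_one_eq n)
        (Nat.cast_nonneg m)) (by norm_num)) h ht x θ (Wiener.eval θ) a
    (fun n => n * m) (fun n => by simp [Wiener.eval_mono])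
    (fun n => by simp [Wiener.eval_mono]) s2
  refine this.trans ?_
  rw [deriv_sinSeries s1 s2]
  rfl

theorem ev_sinDeriv (hs : 4 ≤ s) (ht : 1 < t) (h : t + 1 ≤ s) (x θ : ℝ) (a : SobolevSeq s) :
    ev m t x θ (sinDeriv m h a) = (deriv (sinSeries m a.coeff) x : ℝ) := by
  obtain ⟨s1, s2, -⟩ := summable_freq hs m a
  have := evalWith_embed_cos m
    (e := fun n => (1 / 2 * (|(n : ℝ)| * m) : ℝ) • Wiener.mono 0)
    (τ := 1) (C := 1 / 2 * m) (by positivity) (fun n => by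
      rw [norm_smul, Wiener.norm_mono, mul_one, norm_eq_abs, abs_of_nonneg (by positivity),
        mul_assoc, mul_comm |(n : ℝ)|]
      exact mul_le_mul_of_nonneg_left (mul_le_mul_of_nonneg_left (wt_one_eq n)
        (Nat.cast_nonneg m)) (by norm_num)) h ht x 0 (Wiener.eval θ) a
    (fun n => n * m) (fun n => by simp [Wiener.eval_mono])
    (fun n => by simp [Wiener.eval_mono]) s2
  refine this.trans ?_
  rw [deriv_sinSeries s1 s2, add_zero]
  rfl

end symbols


/-! ### The singular operators and the curvature inside the algebra. -/

theorem preimage_truncated (x ε : ℝ) :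
    (fun θ => x + θ) ⁻¹' {y : ℝ | ε < |x - y| ∧ |x - y| ≤ π} = tailSet ε := by
  ext θ
  simp [tailSet]

section pv

open TorusSeries

variable {t : ℝ}

/-- The substitution `y = x + θ` moves the singularity to `θ = 0`. The real functional `L` is there
to extract a multiple of the real or of the imaginary part. -/
theorem pv_of_ev (ht : 1 < t) (m : ℕ) (g : ℝ → ℝ) (x : ℝ) (L : ℂ →L[ℝ] ℝ) (v : TorusSeries)
    (hg : ∀ θ, θ ≠ 0 → |θ| ≤ π → g (x + θ) = L (cauchyKernel θ * ev m t x θ v)) :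
    PVExists g x ∧ pvIntegral g x = L (ev m t x 0 (pvOp v)) := by
  have hmp := measurePreserving_add_left (volume : Measure ℝ) x
  have hme := measurableEmbedding_addLeft x
  have hgε : ∀ ε : ℝ, 0 < ε → EqOn (fun θ => L (cauchyKernel θ * ev m t x θ v))
      (fun θ => g (x + θ)) (tailSet ε) := fun ε hε θ hθ =>
    (hg θ (abs_pos.1 (hε.trans hθ.1)) hθ.2).symm
  have hi : ∀ ε : ℝ, 0 < ε →
      IntegrableOn (fun θ => cauchyKernel θ * ev m t x θ v) (tailSet ε) := fun ε hε =>
    integrableOn_cauchyKernel_mul hε (continuous_ev ht m x v)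
  have hlim : Tendsto (truncatedIntegral g x) (𝓝[>] 0) (𝓝 (L (ev m t x 0 (pvOp v)))) := by
    rw [ev_pvOp ht]
    refine ((L.continuous.tendsto _).comp (tendsto_pv_ev ht m x v)).congr' ?_
    filter_upwards [self_mem_nhdsWithin] with ε hε
    have h1 : ∫ y in {y : ℝ | ε < |x - y| ∧ |x - y| ≤ π}, g y
        = L (∫ θ in tailSet ε, cauchyKernel θ * ev m t x θ v) := by
      rw [← hmp.setIntegral_preimage_emb hme, preimage_truncated,
        ← L.integral_comp_comm (hi ε hε)]
      exact setIntegral_congr_fun (measurableSet_tailSet ε) fun θ hθ => (hgε ε hε hθ).symm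
    rw [truncatedIntegral, h1, Function.comp]
    rw [← Complex.real_smul, map_smul, smul_eq_mul]
  refine ⟨⟨fun ε hε => ?_, _, hlim⟩, hlim.limUnder_eq⟩
  rw [← hmp.integrableOn_comp_preimage hme, preimage_truncated]
  exact IntegrableOn.congr_fun (L.integrable_comp (hi ε hε)) (hgε ε hε) (measurableSet_tailSet ε)

end pv

/-- The bound gives `Re w > 0`, and `Im w² = 2 Re w Im w = 0` then forces `w` to be real and
positive. -/
theorem sqrt_eq_of_sq_eq {w : ℂ} {p : ℝ} (h : w ^ 2 = p) (hw : ‖w - 1‖ ≤ 1 / 2) :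
    0 < p ∧ w = (√p : ℝ) := by
  have h1 := (Complex.abs_re_le_norm (w - 1)).trans hw
  rw [Complex.sub_re, Complex.one_re, abs_le] at h1
  have hre : 0 < w.re := by linarith
  have him := congrArg Complex.im h
  have hr := congrArg Complex.re h
  rw [sq, Complex.mul_im, Complex.ofReal_im] at him
  rw [sq, Complex.mul_re, Complex.ofReal_re] at hr
  have hb : w.im = 0 := by
    have : w.re * w.im = 0 := by linarith
    exact (mul_eq_zero.1 this).resolve_left hre.ne'
  rw [hb, mul_zero, sub_zero] at hr
  refine ⟨by rw [← hr]; positivity, ?_⟩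
  apply Complex.ext
  · rw [Complex.ofReal_re, ← hr, Real.sqrt_mul_self hre.le]
  · rw [Complex.ofReal_im, hb]

/-- Twice the denominator is `|a - u b|²`, so `2 / (a - u b)` is the conjugate of `a - u b` divided
by the denominator. -/
theorem kernel_re_im {η : ℝ → ℝ} (hpos : ∀ y, 0 < 1 + 2 * η y) (x θ : ℝ)
    (hu : 1 - Complex.exp (θ * Complex.I) ≠ 0) (g : ℂ)
    (hg : g * ((√(1 + 2 * η x) : ℝ) - Complex.exp (θ * Complex.I) * (√(1 + 2 * η (x + θ)) : ℝ))
      = 1 - Complex.exp (θ * Complex.I)) :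
    cauchyKernel θ * g = ⟨(√(1 + 2 * η x) - √(1 + 2 * η (x + θ)) * cos θ)
        / sheetDenominator η x (x + θ),
      √(1 + 2 * η (x + θ)) * sin θ / sheetDenominator η x (x + θ)⟩ := by
  set a := √(1 + 2 * η x) with ha
  set b := √(1 + 2 * η (x + θ)) with hb
  have ha2 : a ^ 2 = 1 + 2 * η x := Real.sq_sqrt (hpos x).le
  have hb2 : b ^ 2 = 1 + 2 * η (x + θ) := Real.sq_sqrt (hpos _).le
  set D := sheetDenominator η x (x + θ) with hD
  have hD' : 2 * D = a ^ 2 + b ^ 2 - 2 * (a * b * cos θ) := by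
    have : x - (x + θ) = -θ := by ring
    rw [hD, sheetDenominator, this, cos_neg, ha2, hb2]; ring
  have hexp : Complex.exp (θ * Complex.I) = ⟨cos θ, sin θ⟩ :=
    Complex.ext (Complex.exp_ofReal_mul_I_re θ) (Complex.exp_ofReal_mul_I_im θ)
  set u := Complex.exp (θ * Complex.I) with hu'
  have hz : (a : ℂ) - u * b ≠ 0 := by
    intro h; rw [h, mul_zero] at hg; exact hu hg.symm
  have hz2 : (a : ℂ) - u * b = ⟨a - cos θ * b, -(sin θ * b)⟩ := by
    rw [hexp]; apply Complex.ext <;> simp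
  -- A zero denominator would give `a = u b`, which `hg` excludes as long as `u ≠ 1`.
  have hD0 : D ≠ 0 := by
    intro h0
    apply hz
    rw [h0] at hD'
    have hs := sin_sq_add_cos_sq θ
    have h1 : (a - cos θ * b) ^ 2 + (sin θ * b) ^ 2 = 0 := by
      have : (a - cos θ * b) ^ 2 + (sin θ * b) ^ 2 = a ^ 2 + b ^ 2 - 2 * (a * b * cos θ) := by
        linear_combination b ^ 2 * hs
      rw [this, ← hD']; ring
    have h2 : a - cos θ * b = 0 := by nlinarith [sq_nonneg (a - cos θ * b), sq_nonneg (sin θ * b)]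
    have h3 : sin θ * b = 0 := by nlinarith [sq_nonneg (a - cos θ * b), sq_nonneg (sin θ * b)]
    rw [hz2, h2, h3, neg_zero]; rfl
  have h1 : cauchyKernel θ * g * ((a : ℂ) - u * b) = 2 := by
    rw [mul_assoc, hg, cauchyKernel, div_mul_cancel₀ _ hu]
  have h2 : (⟨(a - b * cos θ) / D, b * sin θ / D⟩ : ℂ) * ((a : ℂ) - u * b) = 2 := by
    rw [hz2]
    have hs := sin_sq_add_cos_sq θ
    apply Complex.ext
    · simp only [Complex.mul_re, Complex.re_ofNat]
      field_simp
      linear_combination b ^ 2 * hs - hD'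
    · simp only [Complex.mul_im, Complex.im_ofNat]
      field_simp
      ring
  exact mul_right_cancel₀ hz (h1.trans h2.symm)

section operators

open TorusSeries

variable {t : ℝ}

/-- The numerator of `𝒟₀` is `(a - b cos θ) / a`. That of `ℋ₀` is `-a b sin θ`, as `x - y = -θ`. -/
theorem pv_D0_H0 (ht : 1 < t) (m : ℕ) {η ω : ℝ → ℝ} (hpos : ∀ y, 0 < 1 + 2 * η y) (x : ℝ)
    (G w : TorusSeries)
    (hG : ∀ θ : ℝ, ev m t x θ G * ((√(1 + 2 * η x) : ℝ) - Complex.exp (θ * Complex.I) *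
      (√(1 + 2 * η (x + θ)) : ℝ)) = 1 - Complex.exp (θ * Complex.I))
    (hw : ∀ θ, ev m t x θ w = (ω (x + θ) : ℝ)) :
    (PVExists (D0Integrand η ω x) x ∧
      opD0 η ω x = (√(1 + 2 * η x))⁻¹ * (ev m t x 0 (pvOp (mul ht G w))).re) ∧
    (PVExists (H0Integrand η ω x) x ∧
      opH0 η ω x = -√(1 + 2 * η x) * (ev m t x 0 (pvOp (mul ht G w))).im) := by
  have hk : ∀ θ, θ ≠ 0 → |θ| ≤ π → cauchyKernel θ * ev m t x θ (mul ht G w)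
      = ⟨(√(1 + 2 * η x) - √(1 + 2 * η (x + θ)) * cos θ) / sheetDenominator η x (x + θ),
      √(1 + 2 * η (x + θ)) * sin θ / sheetDenominator η x (x + θ)⟩ * (ω (x + θ) : ℝ) := by
    intro θ h0 h1
    rw [ev_mul, hw, ← mul_assoc,
      kernel_re_im hpos x θ (one_sub_exp_ne_zero h0 h1) _ (hG θ)]
  have ha : 0 < √(1 + 2 * η x) := Real.sqrt_pos.2 (hpos x)
  have hθ : ∀ θ : ℝ, x - (x + θ) = -θ := fun θ => by ring
  constructor
  · have := pv_of_ev ht m (D0Integrand η ω x) x ((√(1 + 2 * η x))⁻¹ • Complex.reCLM)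
      (mul ht G w) (fun θ h0 h1 => by
        rw [hk θ h0 h1, D0Integrand, hθ, cos_neg, Real.sqrt_div (hpos _).le]
        simp
        field_simp)
    simpa [opD0] using this
  · have := pv_of_ev ht m (H0Integrand η ω x) x ((-√(1 + 2 * η x)) • Complex.imCLM)
      (mul ht G w) (fun θ h0 h1 => by
        rw [hk θ h0 h1, H0Integrand, hθ, sin_neg]
        simp
        field_simp)
    simpa [opH0] using this

theorem sheetCurvature_eq {η : ℝ → ℝ} {x q τ : ℝ} (hpos : 0 < 1 + 2 * η x)
    (hq : q = (√(1 + 2 * η x))⁻¹) (hτ : τ = √(1 + 2 * η x + (deriv η x * q) ^ 2)) :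
    sheetCurvature η x
      = (deriv (deriv η) x - 2 * (deriv η x * q) ^ 2) * (τ⁻¹) ^ 3 - τ⁻¹ := by
  have hT : 0 < 1 + 2 * η x + (deriv η x * q) ^ 2 := by positivity
  have e1 : √(1 + 2 * η x) ^ 2 + (deriv η x / √(1 + 2 * η x)) ^ 2
      = 1 + 2 * η x + (deriv η x * q) ^ 2 := by
    rw [Real.sq_sqrt hpos.le, hq, div_eq_mul_inv]
  have e2 : (1 + 2 * η x + (deriv η x * q) ^ 2) ^ (-(1 / 2) : ℝ) = τ⁻¹ := by
    rw [rpow_neg hT.le, hτ, Real.sqrt_eq_rpow]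
  have e3 : (1 + 2 * η x + (deriv η x * q) ^ 2) ^ (3 / 2 : ℝ) = τ ^ 3 := by
    rw [hτ, Real.sqrt_eq_rpow, ← rpow_mul_natCast hT.le]
    norm_num
  rw [sheetCurvature, e1, e2, e3, div_eq_mul_inv, inv_pow, div_eq_mul_inv (deriv η x), ← hq]

/-- Identifies the complex square roots of `exists_profile` with the real ones, by their closeness
to `1`. The radius depends on `η` alone being small; no condition on `ψ` is needed. -/
theorem exists_geometry {s : ℝ} (hs : 4 ≤ s) (ht : 1 < t) (hts : t + 1 ≤ s) (m : ℕ) :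
    ∃ r : ℝ, 0 < r ∧ ∃ R Q G W : SobolevSeq s → TorusSeries,
      (ContDiffOn ℝ 1 R (Metric.ball 0 r) ∧ ContDiffOn ℝ 1 Q (Metric.ball 0 r) ∧
        ContDiffOn ℝ 1 G (Metric.ball 0 r) ∧ ContDiffOn ℝ 1 W (Metric.ball 0 r)) ∧
      ∀ a ∈ Metric.ball (0 : SobolevSeq s) r, ∀ η : ℝ → ℝ, η = cosSeries m a.coeff →
        ∀ x, 0 < 1 + 2 * η x ∧ ∀ θ,
          ev m t x θ (R a) = (√(1 + 2 * η x) : ℝ) ∧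
          ev m t x θ (Q a) = ((√(1 + 2 * η x))⁻¹ : ℝ) ∧
          ev m t x θ (G a) * ((√(1 + 2 * η x) : ℝ) - Complex.exp (θ * Complex.I) *
            (√(1 + 2 * η (x + θ)) : ℝ)) = 1 - Complex.exp (θ * Complex.I) ∧
          ev m t x θ (W a)
            = ((√(1 + 2 * η x + (deriv η x * (√(1 + 2 * η x))⁻¹) ^ 2))⁻¹ : ℝ) := by
  have h0 : t + 0 ≤ s := by linarith
  obtain ⟨R, Q, G, W, h⟩ := exists_profile ht m (cosAt h0) (cosShift m h0) (cosQuot m hts)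
    (cosDeriv m hts)
  obtain ⟨r, hr, hb⟩ := Metric.eventually_nhds_iff_ball.1 h
  refine ⟨r, hr, R, Q, G, W, ⟨fun a ha => ((hb a ha).1.1).contDiffWithinAt,
    fun a ha => ((hb a ha).1.2.1).contDiffWithinAt,
    fun a ha => ((hb a ha).1.2.2.1).contDiffWithinAt,
    fun a ha => ((hb a ha).1.2.2.2).contDiffWithinAt⟩, ?_⟩
  rintro a ha η rfl x
  have key := fun θ => (hb a ha).2 x θ
  simp only [ev_cosAt hs ht, ev_cosShift hs ht, ev_cosDeriv hs ht] at key
  set η := cosSeries m a.coeff with hη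
  refine ⟨?_, fun θ => ?_⟩
  · obtain ⟨ρ, τ, ⟨h1, h2⟩, -⟩ := key 0
    exact (sqrt_eq_of_sq_eq (by rw [h1]; push_cast; rfl) h2).1
  · obtain ⟨ρ, τ, ⟨h1, h2⟩, ⟨h3, h4⟩, ⟨h5, h6⟩, h7, h8, h9⟩ := key θ
    obtain ⟨p1, e1⟩ := sqrt_eq_of_sq_eq (p := 1 + 2 * η x) (by rw [h1]; push_cast; rfl) h2
    obtain ⟨p2, e2⟩ := sqrt_eq_of_sq_eq (p := 1 + 2 * η (x + θ)) (by rw [h3]; push_cast; rfl) h4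
    have hne : ((√(1 + 2 * η x) : ℝ) : ℂ) ≠ 0 :=
      Complex.ofReal_ne_zero.2 (Real.sqrt_pos.2 p1).ne'
    rw [e1] at h7
    have e3 : ev m t x θ (Q a) = ((√(1 + 2 * η x))⁻¹ : ℝ) := by
      rw [eq_inv_of_mul_eq_one_left h7]; push_cast; rfl
    obtain ⟨p4, e4⟩ := sqrt_eq_of_sq_eq
      (p := 1 + 2 * η x + (deriv η x * (√(1 + 2 * η x))⁻¹) ^ 2) (by
        rw [h5, e3]; push_cast; linear_combination
          (-(((deriv η x : ℝ) : ℂ) * ((√(1 + 2 * η x) : ℝ) : ℂ)⁻¹) ^ 2) * Complex.I_sq) h6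
    refine ⟨e1, e3, ?_, ?_⟩
    · rw [← e1, ← e2]
      exact h9 _ (ev_cosQuot hs ht hts x θ a)
    · rw [e4] at h8
      rw [eq_inv_of_mul_eq_one_left h8]; push_cast; rfl

end operators


/-! ### Assembling the two components of the functional. -/

/-- The coefficients of an even function. -/
def HEven.toSeq {m : ℕ} {s : ℝ} : HEven m s →L[ℝ] SobolevSeq s := ContinuousLinearMap.id ℝ (SobolevSeq s)

/-- The coefficients of an odd function. -/
def HOdd.toSeq {m : ℕ} {s : ℝ} : HOdd m s →L[ℝ] SobolevSeq s := ContinuousLinearMap.id ℝ (SobolevSeq s)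

/-- The even function with given coefficients. -/
def HEven.ofSeq {m : ℕ} {s : ℝ} : SobolevSeq s →L[ℝ] HEven m s := ContinuousLinearMap.id ℝ (SobolevSeq s)

/-- The odd function with given coefficients. -/
def HOdd.ofSeq {m : ℕ} {s : ℝ} : SobolevSeq s →L[ℝ] HOdd m s := ContinuousLinearMap.id ℝ (SobolevSeq s)

theorem HEven.toFun_eq {m : ℕ} {s : ℝ} (f : HEven m s) :
    f.toFun = cosSeries m (HEven.toSeq f).coeff := rfl

theorem HOdd.toFun_eq {m : ℕ} {s : ℝ} (f : HOdd m s) :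
    f.toFun = sinSeries m (HOdd.toSeq f).coeff := rfl

section functional

open TorusSeries

variable {t : ℝ}

theorem contDiffOn_torusMul {E : Type*} [NormedAddCommGroup E] [NormedSpace ℝ E] (ht : 1 < t)
    {f g : E → TorusSeries} {S : Set E} (hf : ContDiffOn ℝ 1 f S) (hg : ContDiffOn ℝ 1 g S) :
    ContDiffOn ℝ 1 (fun p => mul ht (f p) (g p)) S :=
  ((mul ht).contDiff.comp_contDiffOn hf).clm_apply hg

/-- The function whose imaginary part is `F₁`, in terms of `iη_x`, `R`, `1/R` and the principal
value `N`. -/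
def firstComponent (ht : 1 < t) (c : ℝ) (D R Q N : TorusSeries) : TorusSeries :=
  c • D + (1 / 2 : ℝ) • (mul ht D (mul ht Q N) - mul ht R N)

/-- The function whose real part is `F₂`. -/
def secondComponent (ht : 1 < t) (c σ γ : ℝ) (D E P Q W N : TorusSeries) : TorusSeries :=
  c • P + (1 / 2 : ℝ) • mul ht (P + γ • one) (mul ht Q N)
    + σ • (mul ht (E + (2 : ℝ) • mul ht (mul ht D Q) (mul ht D Q)) (mul ht W (mul ht W W)) - W)

variable {s₁ s₂ : ℝ}

/-- One principal value, with density `ψ_x + γ`, suffices: `N` is linear in the density, so it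
accounts for `½ ℋ[ψ_x]` and `(γ/2) ℋ[1]` at once. `C¹` dependence is polynomial in everything except
`η`. -/
theorem exists_first (hs₁ : 4 ≤ s₁) (hs₂ : 4 ≤ s₂) (ht : 1 < t) (h₁ : t + 1 ≤ s₁)
    (h₂ : t + 1 ≤ s₂) (m : ℕ) :
    ∃ r : ℝ, 0 < r ∧ ∃ A : ℝ × ℝ × ℝ × SobolevSeq s₁ × SobolevSeq s₂ → TorusSeries,
      ContDiffOn ℝ 1 A {p | p.2.2.2.1 ∈ Metric.ball 0 r} ∧
      ∀ (c σ γ : ℝ) (a : SobolevSeq s₁) (b : SobolevSeq s₂), a ∈ Metric.ball 0 r →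
        (∀ x, 0 < 1 + 2 * cosSeries m a.coeff x) ∧
        (∀ x, PVExists (D0Integrand (cosSeries m a.coeff) (deriv (sinSeries m b.coeff)) x) x ∧
          PVExists (D0Integrand (cosSeries m a.coeff) (fun _ => 1) x) x ∧
          PVExists (D0Integrand (cosSeries m a.coeff)
            (fun y => deriv (sinSeries m b.coeff) y + γ) x) x ∧
          PVExists (H0Integrand (cosSeries m a.coeff) (deriv (sinSeries m b.coeff)) x) x ∧
          PVExists (H0Integrand (cosSeries m a.coeff) (fun _ => 1) x) x) ∧
        ∀ x, (ev m t x 0 (A (c, σ, γ, a, b))).im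
          = functionalF1 c γ (cosSeries m a.coeff) (sinSeries m b.coeff) x := by
  obtain ⟨r, hr, R, Q, G, W, ⟨hR, hQ, hG, -⟩, hgeo⟩ := exists_geometry hs₁ ht h₁ m
  refine ⟨r, hr, fun p => firstComponent ht p.1 (cosDeriv m h₁ p.2.2.2.1) (R p.2.2.2.1)
    (Q p.2.2.2.1) (pvOp (mul ht (G p.2.2.2.1)
      (sinDerivShift m h₂ p.2.2.2.2 + p.2.2.1 • one))), ?_, ?_⟩
  · set S : Set (ℝ × ℝ × ℝ × SobolevSeq s₁ × SobolevSeq s₂) := {p | p.2.2.2.1 ∈ Metric.ball 0 r}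
    have hη : ContDiffOn ℝ 1
        (fun p : ℝ × ℝ × ℝ × SobolevSeq s₁ × SobolevSeq s₂ => p.2.2.2.1) S := by fun_prop
    have hmaps : MapsTo (fun p : ℝ × ℝ × ℝ × SobolevSeq s₁ × SobolevSeq s₂ => p.2.2.2.1) S
      (Metric.ball 0 r) := fun p hp => hp
    have kR := hR.comp hη hmaps
    have kQ := hQ.comp hη hmaps
    have kG := hG.comp hη hmaps
    have kD : ContDiffOn ℝ 1 (fun p : ℝ × ℝ × ℝ × SobolevSeq s₁ × SobolevSeq s₂ =>
        cosDeriv (t := t) m h₁ p.2.2.2.1) S := by fun_prop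
    have kw : ContDiffOn ℝ 1 (fun p : ℝ × ℝ × ℝ × SobolevSeq s₁ × SobolevSeq s₂ =>
        sinDerivShift (t := t) m h₂ p.2.2.2.2 + p.2.2.1 • one) S := by fun_prop
    have kN := pvOp.contDiff.comp_contDiffOn (contDiffOn_torusMul ht kG kw)
    have kc : ContDiffOn ℝ 1
        (fun p : ℝ × ℝ × ℝ × SobolevSeq s₁ × SobolevSeq s₂ => p.1) S := by fun_prop
    have k₁ := contDiffOn_torusMul ht kD (contDiffOn_torusMul ht kQ kN)
    have k₂ := contDiffOn_torusMul ht kR kN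
    exact (kc.smul kD).add ((k₁.sub k₂).const_smul _)
  · intro c σ γ a b ha
    have hg := hgeo a ha _ rfl
    set η := cosSeries m a.coeff with hη
    set ψ := sinSeries m b.coeff with hψ
    have hpos : ∀ x, 0 < 1 + 2 * η x := fun x => (hg x).1
    have p1 := fun x => pv_D0_H0 (ω := deriv ψ) ht m hpos x (G a) (sinDerivShift m h₂ b)
      (fun θ => ((hg x).2 θ).2.2.1) (fun θ => ev_sinDerivShift hs₂ ht h₂ x θ b)
    have p2 := fun x => pv_D0_H0 (ω := fun _ => 1) ht m hpos x (G a) one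
      (fun θ => ((hg x).2 θ).2.2.1) (fun θ => by rw [ev_one ht]; simp)
    have p3 := fun x => pv_D0_H0 (ω := fun y => deriv ψ y + γ) ht m hpos x (G a)
      (sinDerivShift m h₂ b + γ • one) (fun θ => ((hg x).2 θ).2.2.1) (fun θ => by
        rw [map_add, map_smul, ev_one ht, ev_sinDerivShift hs₂ ht]; simp [hψ])
    refine ⟨hpos, fun x => ⟨(p1 x).1.1, (p2 x).1.1, (p3 x).1.1, (p1 x).2.1, (p2 x).2.1⟩, fun x => ?_⟩
    rw [functionalF1, opH, opH, (p1 x).1.2, (p1 x).2.2, (p2 x).1.2, (p2 x).2.2]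
    simp only [firstComponent, map_add, map_sub, map_smul, ev_mul, ev_cosDeriv hs₁ ht]
    rw [((hg x).2 0).1, ((hg x).2 0).2.1, ← hη]
    simp only [Complex.real_smul, Complex.add_im, Complex.sub_im, Complex.mul_im, Complex.mul_re,
      Complex.add_re, Complex.sub_re,
      Complex.ofReal_re, Complex.ofReal_im, Complex.I_re, Complex.I_im]
    ring

/-- The term `η_xx` in the curvature is responsible for `t + 2 ≤ s₁`. -/
theorem exists_second (hs₁ : 4 ≤ s₁) (hs₂ : 4 ≤ s₂) (ht : 1 < t) (h₁ : t + 2 ≤ s₁)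
    (h₂ : t + 1 ≤ s₂) (m : ℕ) :
    ∃ r : ℝ, 0 < r ∧ ∃ A : ℝ × ℝ × ℝ × SobolevSeq s₁ × SobolevSeq s₂ → TorusSeries,
      ContDiffOn ℝ 1 A {p | p.2.2.2.1 ∈ Metric.ball 0 r} ∧
      ∀ (c σ γ : ℝ) (a : SobolevSeq s₁) (b : SobolevSeq s₂), a ∈ Metric.ball 0 r →
        ∀ x, (ev m t x 0 (A (c, σ, γ, a, b))).re
          = functionalF2 c σ γ (cosSeries m a.coeff) (sinSeries m b.coeff) x := by
  have h₁' : t + 1 ≤ s₁ := by linarith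
  obtain ⟨r, hr, R, Q, G, W, ⟨hR, hQ, hG, hW⟩, hgeo⟩ := exists_geometry hs₁ ht h₁' m
  refine ⟨r, hr, fun p => secondComponent ht p.1 p.2.1 p.2.2.1 (cosDeriv m h₁' p.2.2.2.1)
    (cosDeriv₂ m h₁ p.2.2.2.1) (sinDeriv m h₂ p.2.2.2.2) (Q p.2.2.2.1) (W p.2.2.2.1)
    (pvOp (mul ht (G p.2.2.2.1) (sinDerivShift m h₂ p.2.2.2.2 + p.2.2.1 • one))), ?_, ?_⟩
  · set S : Set (ℝ × ℝ × ℝ × SobolevSeq s₁ × SobolevSeq s₂) := {p | p.2.2.2.1 ∈ Metric.ball 0 r}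
    have hη : ContDiffOn ℝ 1
        (fun p : ℝ × ℝ × ℝ × SobolevSeq s₁ × SobolevSeq s₂ => p.2.2.2.1) S := by fun_prop
    have hmaps : MapsTo (fun p : ℝ × ℝ × ℝ × SobolevSeq s₁ × SobolevSeq s₂ => p.2.2.2.1) S
      (Metric.ball 0 r) := fun p hp => hp
    have kQ := hQ.comp hη hmaps
    have kG := hG.comp hη hmaps
    have kW := hW.comp hη hmaps
    have kD : ContDiffOn ℝ 1 (fun p : ℝ × ℝ × ℝ × SobolevSeq s₁ × SobolevSeq s₂ =>
        cosDeriv (t := t) m h₁' p.2.2.2.1) S := by fun_prop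
    have kE : ContDiffOn ℝ 1 (fun p : ℝ × ℝ × ℝ × SobolevSeq s₁ × SobolevSeq s₂ =>
        cosDeriv₂ (t := t) m h₁ p.2.2.2.1) S := by fun_prop
    have kP : ContDiffOn ℝ 1 (fun p : ℝ × ℝ × ℝ × SobolevSeq s₁ × SobolevSeq s₂ =>
        sinDeriv (t := t) m h₂ p.2.2.2.2) S := by fun_prop
    have kP' : ContDiffOn ℝ 1 (fun p : ℝ × ℝ × ℝ × SobolevSeq s₁ × SobolevSeq s₂ =>
        sinDeriv (t := t) m h₂ p.2.2.2.2 + p.2.2.1 • one) S := by fun_prop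
    have kw : ContDiffOn ℝ 1 (fun p : ℝ × ℝ × ℝ × SobolevSeq s₁ × SobolevSeq s₂ =>
        sinDerivShift (t := t) m h₂ p.2.2.2.2 + p.2.2.1 • one) S := by fun_prop
    have kN := pvOp.contDiff.comp_contDiffOn (contDiffOn_torusMul ht kG kw)
    have kc : ContDiffOn ℝ 1
        (fun p : ℝ × ℝ × ℝ × SobolevSeq s₁ × SobolevSeq s₂ => p.1) S := by fun_prop
    have kσ : ContDiffOn ℝ 1
        (fun p : ℝ × ℝ × ℝ × SobolevSeq s₁ × SobolevSeq s₂ => p.2.1) S := by fun_prop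
    have kDQ := contDiffOn_torusMul ht kD kQ
    have kF := contDiffOn_torusMul ht kP' (contDiffOn_torusMul ht kQ kN)
    have kK := contDiffOn_torusMul ht (kE.add ((contDiffOn_torusMul ht kDQ kDQ).const_smul (2 : ℝ)))
      (contDiffOn_torusMul ht kW (contDiffOn_torusMul ht kW kW))
    exact ((kc.smul kP).add (kF.const_smul _)).add (kσ.smul (kK.sub kW))
  · intro c σ γ a b ha x
    have hg := hgeo a ha _ rfl
    set η := cosSeries m a.coeff with hη
    set ψ := sinSeries m b.coeff with hψ
    have hpos : ∀ x, 0 < 1 + 2 * η x := fun x => (hg x).1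
    have p3 := pv_D0_H0 (ω := fun y => deriv ψ y + γ) ht m hpos x (G a)
      (sinDerivShift m h₂ b + γ • one) (fun θ => ((hg x).2 θ).2.2.1) (fun θ => by
        rw [map_add, map_smul, ev_one ht, ev_sinDerivShift hs₂ ht]; simp [hψ])
    rw [functionalF2, p3.1.2, sheetCurvature_eq (hpos x) rfl rfl]
    set N := pvOp (mul ht (G a) (sinDerivShift m h₂ b + γ • one))
    have eadd : ∀ v w, ev m t x 0 (v + w) = ev m t x 0 v + ev m t x 0 w := map_add _
    simp only [secondComponent, eadd, map_sub, map_smul, ev_mul, ev_cosDeriv hs₁ ht,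
      ev_cosDeriv₂ hs₁ ht, ev_sinDeriv hs₂ ht, ev_one ht]
    rw [((hg x).2 0).2.1, ((hg x).2 0).2.2.2, ← hη, ← hψ]
    simp only [Complex.real_smul]
    set q := (√(1 + 2 * η x))⁻¹
    set w := (√(1 + 2 * η x + (deriv η x * q) ^ 2))⁻¹
    set n := ev m t x 0 N
    -- Isolates the only non-real quantity `n`; the square of `i η_x q` supplies the sign of `-2
    -- (η_x/R)²`.
    have e : (c : ℂ) * (deriv ψ x : ℝ) + (1 / 2 : ℝ) * (((deriv ψ x : ℝ) + γ * 1) * ((q : ℝ) * n))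
        + σ * (((deriv (deriv η) x : ℝ) + (2 : ℝ) * (((deriv η x : ℝ) * Complex.I * (q : ℝ)) *
          ((deriv η x : ℝ) * Complex.I * (q : ℝ)))) * ((w : ℝ) * ((w : ℝ) * (w : ℝ))) - (w : ℝ))
        = (1 / 2 * (deriv ψ x + γ) * q : ℝ) * n + ((c * deriv ψ x + σ * ((deriv (deriv η) x
          - 2 * (deriv η x * q) ^ 2) * w ^ 3 - w) : ℝ) : ℂ) := by
      push_cast
      linear_combination (2 * σ * (deriv η x : ℝ) ^ 2 * q ^ 2 * w ^ 3 : ℂ) * Complex.I_sq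
    rw [e, Complex.add_re, Complex.re_ofReal_mul, Complex.ofReal_re]
    ring

end functional

end

/-- The second component of the functional takes its values in a space of functions of mean zero
and is understood modulo additive constants, whence the constant `k`. -/
theorem proposition2p2 (m : ℕ) (hm : 1 ≤ m) :
    ∃ s₀ : ℝ, 0 < s₀ ∧ ∀ s : ℝ, s₀ ≤ s → ∃ r : ℝ, 0 < r ∧
      ∃ F : ℝ × ℝ × ℝ × XSpace m s → YSpace m s,
        (∀ c σ γ : ℝ, 0 < σ → ∀ u ∈ smallBall m s r,
          (∀ x : ℝ, Summable (u.1.term x) ∧ Summable (u.2.term x)) ∧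
          FormulasMeaningful γ u.1.toFun u.2.toFun ∧
          (∀ x : ℝ, HasSum ((F (c, σ, γ, u)).1.term x)
            (functionalF1 c γ u.1.toFun u.2.toFun x)) ∧
          (∃ k : ℝ, ∀ x : ℝ, HasSum ((F (c, σ, γ, u)).2.term x)
            (functionalF2 c σ γ u.1.toFun u.2.toFun x - k))) ∧
        ContDiffOn ℝ 1 F (univ ×ˢ Ioi (0 : ℝ) ×ˢ univ ×ˢ smallBall m s r) := by
  -- The value `10` is generous: the inequalities below hold as soon as `s ≥ 17/4`.
  refine ⟨10, by norm_num, fun s hs => ?_⟩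
  have hs₁ : 4 ≤ s + 1 / 4 := by linarith
  have hs₂ : 4 ≤ s - 1 / 4 := by linarith
  have ht : 1 < s - 5 / 4 := by linarith
  have ht' : 1 < s - 7 / 4 := by linarith
  obtain ⟨r₁, hr₁, A, hA, hA'⟩ := exists_first hs₁ hs₂ ht (by linarith) (by linarith) m
  -- The target indices are sharp for this count of derivatives: `(s - 7/4) + 2 = s + 1/4` for
  -- `η_xx`, and in the first component `(s - 5/4) + 1 = s - 1/4` for `ψ_x`.
  obtain ⟨r₂, hr₂, B, hB, hB'⟩ := exists_second hs₁ hs₂ ht' (by linarith) (by linarith) m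
  set ι : ℝ × ℝ × ℝ × XSpace m s → ℝ × ℝ × ℝ × SobolevSeq (s + 1 / 4) × SobolevSeq (s - 1 / 4) :=
    fun p => (p.1, p.2.1, p.2.2.1, HEven.toSeq p.2.2.2.1, HOdd.toSeq p.2.2.2.2) with hι
  have hneg : |(-1 : ℝ)| ≤ 1 := by norm_num
  have hone : |(1 : ℝ)| ≤ 1 := by norm_num
  have hsmall : ∀ u ∈ smallBall m s (min r₁ r₂),
      HEven.toSeq u.1 ∈ Metric.ball 0 r₁ ∧ HEven.toSeq u.1 ∈ Metric.ball 0 r₂ := by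
    intro u hu
    have h1 : ‖u.1‖ + ‖u.2‖ < min r₁ r₂ := hu
    have h2 : ‖HEven.toSeq u.1‖ < min r₁ r₂ :=
      lt_of_le_of_lt (le_add_of_nonneg_right (norm_nonneg u.2)) h1
    rw [mem_ball_zero_iff, mem_ball_zero_iff]
    exact lt_min_iff.1 h2
  refine ⟨min r₁ r₂, lt_min hr₁ hr₂, fun p =>
    (HOdd.ofSeq (TorusSeries.fold (s - 5 / 4) hneg (A (ι p))),
      HEven.ofSeq (TorusSeries.fold (s - 7 / 4) hone (B (ι p)))), ?_, ?_⟩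
  · intro c σ γ _ u hu
    obtain ⟨hu1, hu2⟩ := hsmall u hu
    obtain ⟨hpos, hpv, hF1⟩ := hA' c σ γ _ (HOdd.toSeq u.2) hu1
    have hF2 := hB' c σ γ _ (HOdd.toSeq u.2) hu2
    obtain ⟨a0, a1, a2⟩ := summable_freq hs₁ m (HEven.toSeq u.1)
    obtain ⟨b0, b1, -⟩ := summable_freq hs₂ m (HOdd.toSeq u.2)
    -- The additive constant `k` is the zeroth Fourier coefficient on `θ = 0`, which `fold` omits.
    refine ⟨fun x => ⟨summable_mul_cos a0 x, summable_mul_sin b0 x⟩, ?_, fun x => ?_,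
      Wiener.total (B (ι (c, σ, γ, u)) 0), fun x => ?_⟩
    · exact
        { contDiff_η := contDiff_two_cosSeries a0 a1 a2
          contDiff_ψ := contDiff_one_sinSeries b0 b1
          radius_pos := hpos
          pv_D0_ψx := fun x => (hpv x).1
          pv_D0_one := fun x => (hpv x).2.1
          pv_D0_ψx_add := fun x => (hpv x).2.2.1
          pv_H0_ψx := fun x => (hpv x).2.2.2.1
          pv_H0_one := fun x => (hpv x).2.2.2.2 }
    · rw [HEven.toFun_eq, HOdd.toFun_eq, ← hF1 x]
      exact TorusSeries.hasSum_fold_sin ht m x hneg _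
    · rw [HEven.toFun_eq, HOdd.toFun_eq, ← hF2 x]
      exact TorusSeries.hasSum_fold_cos ht' m x hone _
  · have kι : ContDiff ℝ 1 ι := by fun_prop
    have kA := hA.comp (s := univ ×ˢ Ioi (0 : ℝ) ×ˢ univ ×ˢ smallBall m s (min r₁ r₂))
      kι.contDiffOn fun p hp => (hsmall _ hp.2.2.2).1
    have kB := hB.comp (s := univ ×ˢ Ioi (0 : ℝ) ×ˢ univ ×ˢ smallBall m s (min r₁ r₂))
      kι.contDiffOn fun p hp => (hsmall _ hp.2.2.2).2
    exact (HOdd.ofSeq.contDiff.comp_contDiffOn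
        ((TorusSeries.fold (s - 5 / 4) hneg).contDiff.comp_contDiffOn kA)).prodMk
      (HEven.ofSeq.contDiff.comp_contDiffOn
        ((TorusSeries.fold (s - 7 / 4) hone).contDiff.comp_contDiffOn kB))
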